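/- **Conventions.** Let $(X,d,\mu)$ and $(X',d',\mu')$ be metric spaces with locally finite Borel measures. For sets $E,F,G$ let $\Gamma(E,F,G)$ be the family of all curves (continuous maps) $\gamma:[a,b]\to X$, $a<b$, with $\gamma(a)\in E$, $\gamma(b)\in F$ and $\gamma(t)\in G$ for $t\in(a,b)$. For $p\ge 1$ the $p$-modulus of a curve family $\Gamma$ is $M_p(\Gamma)=\inf\int\rho^p$ (integral with respect to the measure of the space), the infimum being over all Borel $\rho\ge 0$ with values in $[0,\infty]$ such that $\int_\gamma\rho\,ds\ge 1$ for every rectifiable $\gamma\in\Gamma$. A continuum is a nonempty compact connected set; it is nondegenerate if it has more than one point. Write $S(x_0,r)=\{x: d(x,x_0)=r\}$ and $A(x_0,r_1,r_2)=\{x: r_1<d(x,x_0)<r_2\}$. Let $D\subset X$, $D'\subset X'$, let $\alpha,\alpha'$ be real numbers and let $Q:X\to[0,\infty]$ be $\mu$-measurable with $Q=0$ outside $D$. A homeomorphism $f$ of $D$ onto $D'$ is a *ring $Q$-homeomorphism in $\overline D$* if $$M_{\alpha'}\bigl(f(\Gamma(S(x_0,r_1),S(x_0,r_2),A\cap D))\bigr)\le\int_{A\cap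 D}Q(x)\,\eta(d(x,x_0))^{\alpha}\,d\mu(x),\qquad A=A(x_0,r_1,r_2),$$ for every Borel $\eta:(r_1,r_2)\to[0,\infty]$ with $\int_{r_1}^{r_2}\eta(r)\,dr\ge 1$, whenever $x_0\in D$ and $0<r_1<r_2<\operatorname{dist}(x_0,\partial D)$, or $x_0\in\partial D$ and $0<r_1<r_2<\infty$. Here $f(\Gamma)$ denotes the family of the curves $f\circ\gamma$, where $\gamma\in\Gamma$ lies entirely in $D$. The space $X'$ is a *Loewner space with exponent $n$* if for every $t>0$ the infimum of $M_n(\Gamma(E,F,X'))$ over all disjoint nondegenerate continua $E,F\subset X'$ with $\operatorname{dist}(E,F)\le t\,\min\{\operatorname{diam}E,\operatorname{diam}F\}$ is positive. The set $D'$ is a *QED-domain relative to $\overline{D'}$* if there is a finite $K\ge 1$ with $M_{\alpha'}(\Gamma(E,F,X'))\le K\,M_{\alpha'}(\Gamma(E,F,D'))$ for all disjoint continua $E,F\subset\overline{D'}$. The set $D$ is *locally path-connected on $\overline D$* if for every $x\in\overline D$ every neighbourhood $U$ of $x$ contains a neighbourhood $V$ of $x$ such that $V\cap D$ is path-connected.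 **Theorem.** Let $D\subset X$ be open and path-connected and let $D'\subset X'$ be path-connected, with finite Hausdorff dimensions $\alpha\ge 2$ and $\alpha'\ge 2$ respectively. Suppose that $X'$ is a Loewner space with exponent $\alpha'$ and that for some $C\ge 1$ one has $\mu'(\overline{B(x,R)})\le CR^{\alpha'}$ for all closed balls in $X'$. Suppose further that $\overline D$ is compact, that $\partial D$ contains at least two points, that $D$ is locally path-connected on $\overline D$, that $D'$ is a QED-domain relative to $\overline{D'}$, and that $Q\in L^1(D)$. Finally, suppose that any two pairs of points $A\in D$, $B\in\overline D$ and $C\in D$, $F\in\overline D$ with $\{A,B\}\cap\{C,F\}=\varnothing$ can be joined by disjoint curves in $D$, that is, by curves $\gamma_1\in\Gamma(\{A\},\{B\},D)$ and $\gamma_2\in\Gamma(\{C\},\{F\},D)$ with disjoint images. Let $z_0\ne x_0$ be points of $D$, let $z_0'\ne x_0'$ be points of $D'$, and let $\mathfrak H$ be the family of all ring $Q$-homeomorphisms $f$ of $D$ onto $D'$ in $\overline D$ with $f(z_0)=z_0'$ and $f(x_0)=x_0'$. Then for every $f\in\mathfrak H$ the inverse $f^{-1}:D'\to D$ extends to a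 continuous map $\overline{f^{-1}}:\overline{D'}\to\overline D$, and the family of all these extensions, $f\in\mathfrak H$, is equicontinuous at every point of $\overline{D'}$. -/

import Mathlib

open Set Filter Topology MeasureTheory
open scoped ENNReal NNReal

noncomputable section

namespace RingMaps

/-- A curve `γ : [a, b] → X`; values outside `[a, b]` are irrelevant. -/
structure Curve (X : Type*) [MetricSpace X] where
  a : ℝ
  b : ℝ
  lt : a < b
  toFun : ℝ → X
  cont : ContinuousOn toFun (Icc a b)

namespace Curve

variable {X : Type*} [MetricSpace X]

/-- The locus `γ([a, b])`. -/
def carrier (γ : Curve X) : Set X := γ.toFun '' Icc γ.a γ.b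

/-- The length of the curve. -/
def length (γ : Curve X) : ℝ≥0∞ := eVariationOn γ.toFun (Icc γ.a γ.b)

def Rectifiable (γ : Curve X) : Prop := γ.length ≠ ⊤

/-- The line integral `∫_γ ρ ds` along a rectifiable curve, computed in the arc length
parametrization `[0, length γ] → X`. -/
def lineIntegral (γ : Curve X) (ρ : X → ℝ≥0∞) : ℝ≥0∞ :=
  ∫⁻ s in Icc 0 γ.length.toReal, ρ (naturalParameterization γ.toFun (Icc γ.a γ.b) γ.a s)

end Curve

/-- `Γ(E, F, D)`: the curves `γ : [a, b] → X` with `γ(a) ∈ E`, `γ(b) ∈ F` and `γ(t) ∈ D` for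
`t ∈ (a, b)`. -/
def joiningCurves {X : Type*} [MetricSpace X] (E F D : Set X) : Set (Curve X) :=
  {γ | γ.toFun γ.a ∈ E ∧ γ.toFun γ.b ∈ F ∧ ∀ t ∈ Ioo γ.a γ.b, γ.toFun t ∈ D}

/-- Borel functions admissible for the curve family `Γ`. -/
def Admissible {X : Type*} [MetricSpace X] [MeasurableSpace X]
    (Γ : Set (Curve X)) (ρ : X → ℝ≥0∞) : Prop :=
  Measurable ρ ∧ ∀ γ ∈ Γ, γ.Rectifiable → 1 ≤ γ.lineIntegral ρ

/-- The `p`-modulus `M_p(Γ)`. -/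
def modulus {X : Type*} [MetricSpace X] [MeasurableSpace X]
    (μ : Measure X) (p : ℝ) (Γ : Set (Curve X)) : ℝ≥0∞ :=
  ⨅ ρ ∈ {ρ : X → ℝ≥0∞ | Admissible Γ ρ}, ∫⁻ x, ρ x ^ p ∂μ

/-- `f(Γ)` for a map `f` defined on `D` only: the curves `f ∘ γ`, where `γ` runs over the members
of `Γ` that lie in `D`. -/
def imageFamily {X X' : Type*} [MetricSpace X] [MetricSpace X'] {D : Set X}
    (f : D → X') (Γ : Set (Curve X)) : Set (Curve X') :=
  {β | ∃ γ ∈ Γ, β.a = γ.a ∧ β.b = γ.b ∧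
    ∀ t ∈ Icc γ.a γ.b, ∃ h : γ.toFun t ∈ D, β.toFun t = f ⟨γ.toFun t, h⟩}

/-- Nonempty compact connected sets. -/
def IsContinuum {X : Type*} [MetricSpace X] (E : Set X) : Prop := IsCompact E ∧ IsConnected E

/-- `dist(E, F)`. -/
def setDist {X : Type*} [MetricSpace X] (E F : Set X) : ℝ := sInf (image2 dist E F)

/-- The relative distance `Δ(E, F) = dist(E, F) / min {diam E, diam F}`. -/
def relDist {X : Type*} [MetricSpace X] (E F : Set X) : ℝ :=
  setDist E F / min (Metric.diam E) (Metric.diam F)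

/-- The Loewner function `φ_n(t)`: the infimum of `M_n(Γ(E, F, X))` over disjoint nondegenerate
continua `E`, `F` with `Δ(E, F) ≤ t`. -/
def loewnerFunction {X : Type*} [MetricSpace X] [MeasurableSpace X]
    (μ : Measure X) (n : ℝ) (t : ℝ) : ℝ≥0∞ :=
  sInf {m | ∃ E F : Set X, IsContinuum E ∧ E.Nontrivial ∧ IsContinuum F ∧ F.Nontrivial ∧
    Disjoint E F ∧ relDist E F ≤ t ∧ m = modulus μ n (joiningCurves E F univ)}

/-- The space is a Loewner space with exponent `n`. -/
def IsLoewner {X : Type*} [MetricSpace X] [MeasurableSpace X] (μ : Measure X) (n : ℝ) : Prop :=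
  ∀ t : ℝ, 0 < t → 0 < loewnerFunction μ n t

/-- `D` is a QED-domain relative to its closure, with respect to the `p`-modulus. -/
def IsQEDClosure {X : Type*} [MetricSpace X] [MeasurableSpace X]
    (μ : Measure X) (p : ℝ) (D : Set X) : Prop :=
  ∃ A : ℝ≥0, 1 ≤ A ∧ ∀ E F : Set X, IsContinuum E → IsContinuum F →
    E ⊆ closure D → F ⊆ closure D → Disjoint E F →
    modulus μ p (joiningCurves E F univ) ≤ A * modulus μ p (joiningCurves E F D)

/-- `D` is locally path-connected at the point `x` of its closure. -/
def LocPathConnectedAt {X : Type*} [MetricSpace X] (D : Set X) (x : X) : Prop :=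
  ∀ U ∈ 𝓝 x, ∃ V ∈ 𝓝 x, V ⊆ U ∧ IsPathConnected (V ∩ D)

/-- Any two disjoint pairs `A ∈ D, B ∈ closure D` and `C ∈ D, F ∈ closure D` can be joined by
disjoint curves in `D` (only the end points `B`, `F` may lie outside `D`). -/
def DisjointlyJoinable {X : Type*} [MetricSpace X] (D : Set X) : Prop :=
  ∀ A ∈ D, ∀ B ∈ closure D, ∀ C ∈ D, ∀ F ∈ closure D,
    Disjoint ({A, B} : Set X) {C, F} →
    ∃ γ₁ ∈ joiningCurves {A} {B} D, ∃ γ₂ ∈ joiningCurves {C} {F} D,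
      Disjoint γ₁.carrier γ₂.carrier

/-- The spherical ring `A(x₀, r₁, r₂)`. -/
def ring {X : Type*} [MetricSpace X] (x₀ : X) (r₁ r₂ : ℝ) : Set X :=
  {x | r₁ < dist x x₀ ∧ dist x x₀ < r₂}

/-- The ring inequality
`M_{α'}(f(Γ(S(x₀, r₁), S(x₀, r₂), A))) ≤ ∫_A Q(x) η(d(x, x₀))^α dμ(x)`, `A` being the part in `D`
of the ring `A(x₀, r₁, r₂)`, for all `η` with `∫_{r₁}^{r₂} η ≥ 1`. -/
def RingInequality {X X' : Type*} [MetricSpace X] [MeasurableSpace X]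
    [MetricSpace X'] [MeasurableSpace X'] (μ : Measure X) (μ' : Measure X') (α α' : ℝ)
    {D : Set X} (f : D → X') (Q : X → ℝ≥0∞) (x₀ : X) (r₁ r₂ : ℝ) : Prop :=
  ∀ η : ℝ → ℝ≥0∞, Measurable η → 1 ≤ ∫⁻ r in Ioo r₁ r₂, η r →
    modulus μ' α' (imageFamily f (joiningCurves (Metric.sphere x₀ r₁) (Metric.sphere x₀ r₂)
        (ring x₀ r₁ r₂ ∩ D)))
      ≤ ∫⁻ x in ring x₀ r₁ r₂ ∩ D, Q x * η (dist x x₀) ^ α ∂μ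

/-- `f` is a ring `Q`-homeomorphism in the closure of `D`: the ring inequality holds at each point
`x₀ ∈ D` for `0 < r₁ < r₂ < dist(x₀, ∂D)`, and at each point `x₀ ∈ ∂D` for `0 < r₁ < r₂`. -/
def IsRingHomeo {X X' : Type*} [MetricSpace X] [MeasurableSpace X]
    [MetricSpace X'] [MeasurableSpace X'] (μ : Measure X) (μ' : Measure X') (α α' : ℝ)
    {D : Set X} {D' : Set X'} (Q : X → ℝ≥0∞) (f : D ≃ₜ D') : Prop :=
  (∀ x₀ ∈ D, ∀ r₁ r₂ : ℝ, 0 < r₁ → r₁ < r₂ → r₂ < Metric.infDist x₀ (frontier D) →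
    RingInequality μ μ' α α' (fun x : D => (f x : X')) Q x₀ r₁ r₂) ∧
  (∀ x₀ ∈ frontier D, ∀ r₁ r₂ : ℝ, 0 < r₁ → r₁ < r₂ →
    RingInequality μ μ' α α' (fun x : D => (f x : X')) Q x₀ r₁ r₂)

/-- The family of ring `Q`-homeomorphisms `f` of `D` onto `D'`, in the closure of `D`, with
`f(z₀) = z₀'` and `f(x₀) = x₀'`. -/
def ringFamily {X X' : Type*} [MetricSpace X] [MeasurableSpace X]
    [MetricSpace X'] [MeasurableSpace X'] (μ : Measure X) (μ' : Measure X') (α α' : ℝ)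
    {D : Set X} {D' : Set X'} (z₀ x₀ : D) (z₀' x₀' : D') (Q : X → ℝ≥0∞) : Set (D ≃ₜ D') :=
  {f | IsRingHomeo μ μ' α α' Q f ∧ f z₀ = z₀' ∧ f x₀ = x₀'}

/-- `g : closure D' → closure D` is a continuous extension of `f⁻¹ : D' → D`. -/
def IsExtendedInverse {X X' : Type*} [MetricSpace X] [MetricSpace X']
    {D : Set X} {D' : Set X'} (f : D ≃ₜ D') (g : closure D' → closure D) : Prop :=
  Continuous g ∧ ∀ y : D', (g ⟨y, subset_closure y.2⟩ : X) = f.symm y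

end RingMaps

end

/-!
The inverses of the maps `f` in the family oscillate little near every point `z'` of `closure D'`,
uniformly in `f` (`InverseSetting.exists_dist_lt`); extension and equicontinuity are formal
consequences. The uniform bound comes from comparing two estimates of one modulus.

Suppose that points `u`, `w` of `D` stay apart, near distinct points `x`, `y` of the compact set
`closure D`, while `f u` and `f w` are close to `z'`. Choose anchors `A`, `C` with images far from
`z'`, and join `A` to `u` and `C` to `w` in `D` by disjoint compact path-connected sets `E`, `G`.
These can be kept inside fixed disjoint compact neighbourhoods of two fixed curves: disjoint
joinability provides the curves, and local path-connectedness moves their end points.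

* Upper bound (`exists_modulus_image_le`). Finitely many rings, independent of `f`, separate `E`
  from `G`, so every curve joining `f(E)` to `f(G)` in `D'` has a subcurve that is the image of a
  curve crossing one of them. The ring inequality with constant density and `Q ∈ L¹` bound the
  modulus independently of `f`.
* Lower bound (`IsLoewner.exists_lt_modulus`). The sets `f(E)` and `f(G)` have diameter bounded
  below and are close to each other. In the Loewner space `X'` every scale between their distance
  and their size contributes a fixed amount to the modulus: the upper mass bound makes wide rings
  have small modulus, so most of the curves of one scale stay in a ring of that scale, and disjoint
  rings contribute additively. Hence the modulus is as large as desired, and the QED property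
  transfers this to the curves in `D'`.

Anchors for `z' ≠ z₀', x₀'` are `z₀` and `x₀`: one of the two pairings with `x`, `y` is disjoint
(`InverseSetting.exists_separation_of_ne`). For `z' = z₀'` the point `y` is `z₀` itself, and the
missing anchor is found near a boundary point of `D` other than `x`: a compact neighbourhood of
`z₀'` in `D'` has a compact preimage in `D`, so points close to the boundary are mapped out of it
(`InverseSetting.exists_separation_left`). This is where the two boundary points are used.
-/

namespace RingMaps

/-! ### Arc length and line integrals -/

namespace Curve

variable {X : Type*} [MetricSpace X]

/-- The arc length of `γ` from its initial point to the parameter `t`. -/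
noncomputable def arc (γ : Curve X) (t : ℝ) : ℝ :=
  variationOnFromTo γ.toFun (Icc γ.a γ.b) γ.a t

/-- The arc length parametrization of `γ`, on `[0, length γ]`. -/
noncomputable def arcParam (γ : Curve X) : ℝ → X :=
  naturalParameterization γ.toFun (Icc γ.a γ.b) γ.a

variable {γ : Curve X}

lemma left_mem (γ : Curve X) : γ.a ∈ Icc γ.a γ.b := left_mem_Icc.2 γ.lt.le

lemma right_mem (γ : Curve X) : γ.b ∈ Icc γ.a γ.b := right_mem_Icc.2 γ.lt.le

lemma Rectifiable.locallyBoundedVariationOn (hγ : γ.Rectifiable) :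
    LocallyBoundedVariationOn γ.toFun (Icc γ.a γ.b) :=
  BoundedVariationOn.locallyBoundedVariationOn hγ

lemma Rectifiable.continuousOn_arc (hγ : γ.Rectifiable) : ContinuousOn γ.arc (Icc γ.a γ.b) := by
  intro t ht
  have hc := γ.cont t ht
  have h1 := variationOnFromTo.tendsto_left (l := γ.toFun t) γ.left_mem ht
    hγ.locallyBoundedVariationOn (hc.mono inter_subset_left)
  have h2 := variationOnFromTo.tendsto_right (l := γ.toFun t) γ.left_mem ht
    hγ.locallyBoundedVariationOn (hc.mono inter_subset_left)
  rw [dist_self, sub_zero] at h1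
  rw [dist_self, add_zero] at h2
  have h3 : ContinuousWithinAt γ.arc ((Icc γ.a γ.b ∩ Iio t) ∪ (Icc γ.a γ.b ∩ Ioi t)) t :=
    ContinuousWithinAt.union h1 h2
  refine (h3.union (continuousWithinAt_singleton (x := t))).mono ?_
  intro s hs
  rcases lt_trichotomy s t with h | h | h
  · exact Or.inl (Or.inl ⟨hs, h⟩)
  · exact Or.inr h
  · exact Or.inl (Or.inr ⟨hs, h⟩)

lemma arc_left (γ : Curve X) : γ.arc γ.a = 0 := variationOnFromTo.self _ _ _

lemma arc_right (γ : Curve X) : γ.arc γ.b = γ.length.toReal := by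
  rw [arc, variationOnFromTo.eq_of_le _ _ γ.lt.le, inter_self, length]

lemma Rectifiable.monotoneOn_arc (hγ : γ.Rectifiable) : MonotoneOn γ.arc (Icc γ.a γ.b) :=
  variationOnFromTo.monotoneOn hγ.locallyBoundedVariationOn γ.left_mem

lemma Rectifiable.arc_mem (hγ : γ.Rectifiable) {t : ℝ} (ht : t ∈ Icc γ.a γ.b) :
    γ.arc t ∈ Icc 0 γ.length.toReal := by
  rw [← arc_left γ, ← arc_right γ]
  exact ⟨hγ.monotoneOn_arc γ.left_mem ht ht.1, hγ.monotoneOn_arc ht γ.right_mem ht.2⟩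

lemma Rectifiable.exists_arc_eq (hγ : γ.Rectifiable) {s : ℝ} (hs : s ∈ Icc 0 γ.length.toReal) :
    ∃ t ∈ Icc γ.a γ.b, γ.arc t = s := by
  rw [← arc_left γ, ← arc_right γ] at hs
  exact intermediate_value_Icc γ.lt.le hγ.continuousOn_arc hs

lemma Rectifiable.arcParam_arc (hγ : γ.Rectifiable) {t : ℝ} (ht : t ∈ Icc γ.a γ.b) :
    γ.arcParam (γ.arc t) = γ.toFun t :=
  edist_eq_zero.1 (edist_naturalParameterization_eq_zero hγ.locallyBoundedVariationOn γ.left_mem ht)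

lemma Rectifiable.arcParam_mem_carrier (hγ : γ.Rectifiable) {s : ℝ}
    (hs : s ∈ Icc 0 γ.length.toReal) : γ.arcParam s ∈ γ.carrier := by
  obtain ⟨t, ht, rfl⟩ := hγ.exists_arc_eq hs
  rw [hγ.arcParam_arc ht]
  exact mem_image_of_mem _ ht

lemma Rectifiable.dist_le_arc_sub (hγ : γ.Rectifiable) {s t : ℝ} (hs : s ∈ Icc γ.a γ.b)
    (ht : t ∈ Icc γ.a γ.b) (hst : s ≤ t) :
    dist (γ.toFun s) (γ.toFun t) ≤ γ.arc t - γ.arc s := by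
  have hf := hγ.locallyBoundedVariationOn
  rw [arc, arc, variationOnFromTo.sub_right hf γ.left_mem ht hs,
    variationOnFromTo.eq_of_le _ _ hst, dist_edist]
  exact ENNReal.toReal_mono (hf s t hs ht)
    (eVariationOn.edist_le _ ⟨hs, le_rfl, hst⟩ ⟨ht, hst, le_rfl⟩)

lemma Rectifiable.lipschitzOnWith_arcParam (hγ : γ.Rectifiable) :
    LipschitzOnWith 1 γ.arcParam (Icc 0 γ.length.toReal) := by
  refine LipschitzOnWith.of_dist_le_mul fun s hs s' hs' => ?_
  obtain ⟨t, ht, rfl⟩ := hγ.exists_arc_eq hs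
  obtain ⟨t', ht', rfl⟩ := hγ.exists_arc_eq hs'
  rw [hγ.arcParam_arc ht, hγ.arcParam_arc ht', NNReal.coe_one, one_mul, Real.dist_eq]
  rcases le_total t t' with h | h
  · rw [abs_sub_comm]
    exact (hγ.dist_le_arc_sub ht ht' h).trans (le_abs_self _)
  · rw [dist_comm]
    exact (hγ.dist_le_arc_sub ht' ht h).trans (le_abs_self _)

/-- A curve that meets `{dist · p ≤ u}` and `{v ≤ dist · p}` has line integral at least
`∫_u^v η` for the radial density `η (dist · p)`: along the arc length parametrization the distance
to `p` is `1`-Lipschitz and takes every value in `[u, v]`. -/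
lemma Rectifiable.setLIntegral_le_lineIntegral (hγ : γ.Rectifiable) {p x y : X} {u v : ℝ}
    (hx : x ∈ γ.carrier) (hy : y ∈ γ.carrier) (hxu : dist x p ≤ u) (hyv : v ≤ dist y p)
    {η : ℝ → ℝ≥0∞} (hη : Measurable η) :
    ∫⁻ r in Icc u v, η r ≤ γ.lineIntegral fun z => η (dist z p) := by
  set L := γ.length.toReal
  set h : ℝ → ℝ := fun s => dist (γ.arcParam s) p with hh
  have hlip : LipschitzOnWith 1 h (Icc 0 L) := by
    have := (LipschitzWith.dist_left p).comp_lipschitzOnWith hγ.lipschitzOnWith_arcParam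
    rwa [one_mul] at this
  have hmeas : AEMeasurable h (volume.restrict (Icc 0 L)) :=
    hlip.continuousOn.aemeasurable measurableSet_Icc
  have hsub : Icc u v ⊆ h '' Icc 0 L := by
    obtain ⟨t, ht, rfl⟩ := hx
    obtain ⟨t', ht', rfl⟩ := hy
    have hconn : (h '' Icc 0 L).OrdConnected :=
      (isPreconnected_Icc.image h hlip.continuousOn).ordConnected
    have hval : ∀ t ∈ Icc γ.a γ.b, dist (γ.toFun t) p ∈ h '' Icc 0 L := fun t ht =>
      ⟨γ.arc t, hγ.arc_mem ht, by rw [hh]; simp only [hγ.arcParam_arc ht]⟩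
    exact (Icc_subset_Icc hxu hyv).trans (hconn.out (hval t ht) (hval t' ht'))
  have hle : volume.restrict (Icc u v) ≤ (volume.restrict (Icc 0 L)).map h := by
    refine Measure.le_iff.2 fun B hB => ?_
    rw [Measure.map_apply_of_aemeasurable hmeas hB, Measure.restrict_apply hB,
      Measure.restrict_apply' measurableSet_Icc]
    calc volume (B ∩ Icc u v) ≤ volume (h '' (h ⁻¹' B ∩ Icc 0 L)) := by
          refine measure_mono ?_
          rintro r ⟨hrB, hr⟩
          obtain ⟨s, hs, rfl⟩ := hsub hr
          exact ⟨s, ⟨hrB, hs⟩, rfl⟩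
      _ ≤ volume (h ⁻¹' B ∩ Icc 0 L) := by
          have := (hlip.mono (inter_subset_right (s := h ⁻¹' B))).hausdorffMeasure_image_le
            zero_le_one
          simpa [hausdorffMeasure_real] using this
  calc ∫⁻ r in Icc u v, η r ≤ ∫⁻ r, η r ∂((volume.restrict (Icc 0 L)).map h) :=
        lintegral_mono' hle le_rfl
    _ = ∫⁻ s in Icc 0 L, η (h s) := lintegral_map' hη.aemeasurable hmeas

/-- The subcurve of `γ` over a parameter interval `[s, t]`. -/
def restrict (γ : Curve X) {s t : ℝ} (hs : s ∈ Icc γ.a γ.b) (ht : t ∈ Icc γ.a γ.b) (hst : s < t) :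
    Curve X where
  a := s
  b := t
  lt := hst
  toFun := γ.toFun
  cont := γ.cont.mono (Icc_subset_Icc hs.1 ht.2)

lemma Rectifiable.restrict (hγ : γ.Rectifiable) {s t : ℝ} (hs : s ∈ Icc γ.a γ.b)
    (ht : t ∈ Icc γ.a γ.b) (hst : s < t) : (γ.restrict hs ht hst).Rectifiable :=
  ne_top_of_le_ne_top hγ (eVariationOn.mono _ (Icc_subset_Icc hs.1 ht.2))

lemma Rectifiable.arc_restrict (hγ : γ.Rectifiable) {s t r : ℝ} (hs : s ∈ Icc γ.a γ.b)
    (ht : t ∈ Icc γ.a γ.b) (hst : s < t) (hr : r ∈ Icc s t) :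
    (γ.restrict hs ht hst).arc r = γ.arc r - γ.arc s := by
  have hr' : r ∈ Icc γ.a γ.b := ⟨hs.1.trans hr.1, hr.2.trans ht.2⟩
  rw [arc, arc, arc, variationOnFromTo.sub_right hγ.locallyBoundedVariationOn γ.left_mem hr' hs]
  simp only [Curve.restrict]
  rw [variationOnFromTo.eq_of_le _ _ hr.1, variationOnFromTo.eq_of_le _ _ hr.1,
    inter_eq_self_of_subset_right (Icc_subset_Icc le_rfl hr.2),
    inter_eq_self_of_subset_right (Icc_subset_Icc hs.1 hr'.2)]

lemma Rectifiable.lineIntegral_restrict_le (hγ : γ.Rectifiable) {s t : ℝ} (hs : s ∈ Icc γ.a γ.b)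
    (ht : t ∈ Icc γ.a γ.b) (hst : s < t) (ρ : X → ℝ≥0∞) :
    (γ.restrict hs ht hst).lineIntegral ρ ≤ γ.lineIntegral ρ := by
  set β := γ.restrict hs ht hst
  have hβ : β.Rectifiable := hγ.restrict hs ht hst
  have hlen : β.length.toReal = γ.arc t - γ.arc s := by
    rw [← arc_right]
    exact hγ.arc_restrict hs ht hst ⟨hst.le, le_rfl⟩
  have hmp : MeasurePreserving (fun r : ℝ => r + γ.arc s) volume volume :=
    measurePreserving_add_right volume _
  calc β.lineIntegral ρ = ∫⁻ r in Icc 0 β.length.toReal, ρ (β.arcParam r) := rfl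
    _ = ∫⁻ r in Icc 0 β.length.toReal, ρ (γ.arcParam (r + γ.arc s)) := by
        refine setLIntegral_congr_fun measurableSet_Icc fun r hr => ?_
        obtain ⟨q, hq, rfl⟩ := hβ.exists_arc_eq hr
        have hq' : q ∈ Icc γ.a γ.b := ⟨hs.1.trans hq.1, hq.2.trans ht.2⟩
        rw [hβ.arcParam_arc hq, hγ.arc_restrict hs ht hst hq, sub_add_cancel, hγ.arcParam_arc hq']
        rfl
    _ = ∫⁻ r in (fun r : ℝ => r + γ.arc s) ⁻¹' Icc (γ.arc s) (γ.arc t),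
          ρ (γ.arcParam (r + γ.arc s)) := by
        rw [preimage_add_const_Icc, sub_self, hlen]
    _ = ∫⁻ r in Icc (γ.arc s) (γ.arc t), ρ (γ.arcParam r) :=
        hmp.setLIntegral_comp_preimage_emb (MeasurableEquiv.addRight (γ.arc s)).measurableEmbedding
          (fun r => ρ (γ.arcParam r)) _
    _ ≤ γ.lineIntegral ρ :=
        lintegral_mono_set (Icc_subset_Icc (hγ.arc_mem hs).1 (hγ.arc_mem ht).2)

lemma Rectifiable.lineIntegral_congr (hγ : γ.Rectifiable) {ρ σ : X → ℝ≥0∞}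
    (h : EqOn ρ σ γ.carrier) : γ.lineIntegral ρ = γ.lineIntegral σ :=
  setLIntegral_congr_fun measurableSet_Icc fun _ hs => h (hγ.arcParam_mem_carrier hs)

lemma lineIntegral_mono {ρ σ : X → ℝ≥0∞} (h : ρ ≤ σ) : γ.lineIntegral ρ ≤ γ.lineIntegral σ :=
  lintegral_mono fun _ => h _

lemma isCompact_carrier (γ : Curve X) : IsCompact γ.carrier :=
  isCompact_Icc.image_of_continuousOn γ.cont

end Curve

/-! ### Crossing an interval -/

/-- A function on `[a, b]` that passes from values `≤ u` to values `≥ v` has an interval on which it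
runs through `(u, v)`, from the value `u` to the value `v`. -/
lemma exists_crossing {h : ℝ → ℝ} {a b u v : ℝ} (hab : a ≤ b) (hc : ContinuousOn h (Icc a b))
    (huv : u < v) (ha : h a ≤ u) (hb : v ≤ h b) :
    ∃ s t, a ≤ s ∧ s < t ∧ t ≤ b ∧ h s = u ∧ h t = v ∧ ∀ r ∈ Ioo s t, u < h r ∧ h r < v := by
  have hT : IsCompact (Icc a b ∩ h ⁻¹' {v}) :=
    isCompact_Icc.of_isClosed_subset (hc.preimage_isClosed_of_isClosed isClosed_Icc
      isClosed_singleton) inter_subset_left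
  have hTne : (Icc a b ∩ h ⁻¹' {v}).Nonempty := by
    obtain ⟨t, ht, htv⟩ := intermediate_value_Icc hab hc ⟨ha.trans huv.le, hb⟩
    exact ⟨t, ht, htv⟩
  -- the first parameter at which the value `v` is taken
  obtain ⟨t, ⟨⟨hat, htb⟩, htv⟩, hmin⟩ := hT.exists_isLeast hTne
  have hct : ContinuousOn h (Icc a t) := hc.mono (Icc_subset_Icc le_rfl htb)
  have hlt : ∀ r ∈ Ico a t, h r < v := by
    intro r hr
    by_contra! hv
    obtain ⟨q, hq, hqv⟩ := intermediate_value_Icc hr.1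
      (hct.mono (Icc_subset_Icc le_rfl hr.2.le)) ⟨ha.trans huv.le, hv⟩
    exact absurd (hmin ⟨⟨hq.1, hq.2.trans (hr.2.le.trans htb)⟩, hqv⟩)
      (not_le.2 (hq.2.trans_lt hr.2))
  have hS : IsCompact (Icc a t ∩ h ⁻¹' {u}) :=
    isCompact_Icc.of_isClosed_subset (hct.preimage_isClosed_of_isClosed isClosed_Icc
      isClosed_singleton) inter_subset_left
  have htv' : h t = v := htv
  have hSne : (Icc a t ∩ h ⁻¹' {u}).Nonempty := by
    obtain ⟨s, hs, hsu⟩ := intermediate_value_Icc hat hct ⟨ha, huv.le.trans htv'.ge⟩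
    exact ⟨s, hs, hsu⟩
  -- the last parameter before `t` at which the value `u` is taken
  obtain ⟨s, ⟨⟨has, hst⟩, hsu⟩, hmax⟩ := hS.exists_isGreatest hSne
  have hsu' : h s = u := hsu
  have hst' : s < t := lt_of_le_of_ne hst fun e => by rw [e, htv'] at hsu'; exact huv.ne' hsu'
  refine ⟨s, t, has, hst', htb, hsu', htv', fun r hr => ⟨?_, hlt r ⟨has.trans hr.1.le, hr.2⟩⟩⟩
  by_contra! hu
  obtain ⟨q, hq, hqu⟩ := intermediate_value_Icc hr.2.le
    (hct.mono (Icc_subset_Icc (has.trans hr.1.le) le_rfl)) ⟨hu, huv.le.trans htv'.ge⟩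
  exact absurd (hmax ⟨⟨has.trans (hr.1.le.trans hq.1), hq.2⟩, hqu⟩) (not_le.2 (hr.1.trans_le hq.1))

/-! ### The modulus of curve families -/

section Modulus

variable {X : Type*} [MetricSpace X] [MeasurableSpace X] {μ : Measure X} {p : ℝ}
  {Γ Γ' : Set (Curve X)}

lemma modulus_le {ρ : X → ℝ≥0∞} (hρ : Admissible Γ ρ) : modulus μ p Γ ≤ ∫⁻ x, ρ x ^ p ∂μ :=
  iInf₂_le ρ hρ

/-- A family each of whose members has a subcurve in `Γ'` has modulus at most that of `Γ'`. -/
lemma modulus_le_of_restrict_mem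
    (h : ∀ γ ∈ Γ, ∃ (s t : ℝ) (hs : s ∈ Icc γ.a γ.b) (ht : t ∈ Icc γ.a γ.b) (hst : s < t),
      γ.restrict hs ht hst ∈ Γ') : modulus μ p Γ ≤ modulus μ p Γ' := by
  refine le_iInf₂ fun ρ hρ => modulus_le ⟨hρ.1, fun γ hγ hrect => ?_⟩
  obtain ⟨s, t, hs, ht, hst, hmem⟩ := h γ hγ
  exact (hρ.2 _ hmem (hrect.restrict hs ht hst)).trans (hrect.lineIntegral_restrict_le hs ht hst ρ)

lemma modulus_mono (h : Γ ⊆ Γ') : modulus μ p Γ ≤ modulus μ p Γ' :=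
  le_iInf₂ fun _ hρ => modulus_le ⟨hρ.1, fun γ hγ => hρ.2 γ (h hγ)⟩

lemma modulus_empty (hp : 0 < p) : modulus μ p (∅ : Set (Curve X)) = 0 := by
  refine le_antisymm ((modulus_le (ρ := fun _ => 0) ⟨measurable_const, by simp⟩).trans ?_) zero_le
  simp [ENNReal.zero_rpow_of_pos hp]

lemma modulus_union_le :
    modulus μ p (Γ ∪ Γ') ≤ modulus μ p Γ + modulus μ p Γ' := by
  simp only [modulus, ENNReal.iInf_add, ENNReal.add_iInf]
  refine le_iInf₂ fun σ hσ => le_iInf₂ fun ρ hρ => ?_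
  refine (modulus_le (ρ := fun x => max (ρ x) (σ x)) ⟨hρ.1.max hσ.1, ?_⟩).trans ?_
  · rintro γ (hγ | hγ) hrect
    · exact (hρ.2 γ hγ hrect).trans (Curve.lineIntegral_mono fun x => le_max_left _ _)
    · exact (hσ.2 γ hγ hrect).trans (Curve.lineIntegral_mono fun x => le_max_right _ _)
  · rw [← lintegral_add_left (hρ.1.pow_const p)]
    refine lintegral_mono fun x => ?_
    rcases max_cases (ρ x) (σ x) with h | h <;> simp only [h.1]
    · exact le_self_add
    · exact le_add_self

lemma modulus_biUnion_le {ι : Type*} (hp : 0 < p) (s : Finset ι) (Γ : ι → Set (Curve X)) :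
    modulus μ p (⋃ i ∈ s, Γ i) ≤ ∑ i ∈ s, modulus μ p (Γ i) := by
  classical
  induction s using Finset.induction_on with
  | empty => simp [modulus_empty hp]
  | insert i s hi ih =>
    rw [Finset.set_biUnion_insert, Finset.sum_insert hi]
    exact modulus_union_le.trans (add_le_add le_rfl ih)

/-- Superadditivity of the modulus over curve families that live in disjoint sets. -/
lemma sum_modulus_le {ι : Type*} (hp : 0 < p) (s : Finset ι) {A : ι → Set X} {Δ : ι → Set (Curve X)}
    (hA : ∀ i ∈ s, MeasurableSet (A i)) (hdisj : (s : Set ι).PairwiseDisjoint A)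
    (hΔ : ∀ i ∈ s, Δ i ⊆ Γ) (hΔA : ∀ i ∈ s, ∀ γ ∈ Δ i, γ.carrier ⊆ A i) :
    ∑ i ∈ s, modulus μ p (Δ i) ≤ modulus μ p Γ := by
  refine le_iInf₂ fun ρ hρ => ?_
  calc ∑ i ∈ s, modulus μ p (Δ i) ≤ ∑ i ∈ s, ∫⁻ x in A i, ρ x ^ p ∂μ := by
        refine Finset.sum_le_sum fun i hi => ?_
        have hadm : Admissible (Δ i) ((A i).indicator ρ) := by
          refine ⟨hρ.1.indicator (hA i hi), fun γ hγ hrect => ?_⟩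
          rw [hrect.lineIntegral_congr fun x hx => indicator_of_mem (hΔA i hi γ hγ hx) ρ]
          exact hρ.2 γ (hΔ i hi hγ) hrect
        refine (modulus_le hadm).trans (le_of_eq ?_)
        rw [← lintegral_indicator (hA i hi)]
        refine lintegral_congr fun x => ?_
        by_cases hx : x ∈ A i <;> simp [hx, ENNReal.zero_rpow_of_pos hp]
    _ = ∫⁻ x in ⋃ i ∈ s, A i, ρ x ^ p ∂μ := (lintegral_biUnion_finset hdisj hA _).symm
    _ ≤ ∫⁻ x, ρ x ^ p ∂μ := setLIntegral_le_lintegral _ _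

end Modulus

/-! ### The modulus of a ring under the upper mass bound -/

section UpperMassBound

variable {X : Type*} [MetricSpace X] [MeasurableSpace X] [BorelSpace X] {μ : Measure X} {p C : ℝ}

/-- The curves that pass from the closed ball `B(a, r)` to the complement of the open ball
`B(a, R)`, in either direction. -/
def crossingCurves (a : X) (r R : ℝ) : Set (Curve X) :=
  {γ | (∃ x ∈ γ.carrier, dist x a ≤ r) ∧ ∃ y ∈ γ.carrier, R ≤ dist y a}

/-- The density `1 / (dist(·, a) log (R / r))` on the ring shows that crossing a ring of ratio
`R / r = 2 ^ N` has modulus `O(N ^ (1 - p))`: each of the `N` dyadic shells contributes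
`O(N ^ (-p))`. -/
lemma modulus_crossingCurves_le (hp : 0 < p)
    (hC : ∀ (x : X) (R : ℝ), 0 < R → μ (Metric.closedBall x R) ≤ ENNReal.ofReal (C * R ^ p))
    (a : X) {r : ℝ} (hr : 0 < r) {N : ℕ} (hN : 0 < N) :
    modulus μ p (crossingCurves a r (2 ^ N * r)) ≤
      ENNReal.ofReal (N * (C * (2 / (N * Real.log 2)) ^ p)) := by
  set R := 2 ^ N * r with hR
  have hN' : (0 : ℝ) < N := Nat.cast_pos.2 hN
  have hlog2 : 0 < Real.log 2 := Real.log_pos one_lt_two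
  have hrR : r ≤ R := le_mul_of_one_le_left hr.le (one_le_pow₀ one_le_two)
  set c := N * Real.log 2 with hc
  have hc0 : 0 < c := mul_pos hN' hlog2
  set η : ℝ → ℝ≥0∞ := (Ico r R).indicator fun u => ENNReal.ofReal (c⁻¹ * u⁻¹) with hη
  have hηm : Measurable η :=
    (ENNReal.measurable_ofReal.comp (measurable_inv.const_mul _)).indicator measurableSet_Ico
  have hint : ∫⁻ u in Icc r R, η u = 1 := by
    rw [restrict_Ico_eq_restrict_Icc.symm, hη, setLIntegral_indicator measurableSet_Ico, inter_self,
      restrict_Ico_eq_restrict_Ioc, ← ofReal_integral_eq_lintegral_ofReal,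
      ← intervalIntegral.integral_of_le hrR, intervalIntegral.integral_const_mul,
      integral_inv_of_pos hr (hr.trans_le hrR), hR, mul_div_cancel_right₀ _ hr.ne', Real.log_pow,
      inv_mul_cancel₀ hc0.ne', ENNReal.ofReal_one]
    · have hcont : ContinuousOn (fun u : ℝ => u⁻¹) (Icc r R) :=
        continuousOn_inv₀.mono fun u hu => (hr.trans_le hu.1).ne'
      exact (hcont.integrableOn_Icc.mono_set Ioc_subset_Icc_self).const_mul _
    · refine (ae_restrict_mem measurableSet_Ioc).mono fun u hu => ?_
      have : 0 < u := hr.trans hu.1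
      simp only [Pi.zero_apply]
      positivity
  have hadm : Admissible (crossingCurves a r R) fun z => η (dist z a) := by
    refine ⟨hηm.comp (continuous_id.dist continuous_const).measurable, ?_⟩
    rintro γ ⟨⟨x, hx, hxr⟩, y, hy, hyR⟩ hrect
    rw [← hint]
    exact hrect.setLIntegral_le_lineIntegral hx hy hxr hyR hηm
  set S : ℕ → Set X := fun j => {z | 2 ^ j * r ≤ dist z a ∧ dist z a < 2 ^ (j + 1) * r} with hS
  have hSm : ∀ j, MeasurableSet (S j) := fun j =>
    (continuous_id.dist continuous_const).measurable measurableSet_Ico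
  -- the dyadic shells `S 0, …, S (n - 1)` cover the ring of ratio `2 ^ n`
  have hcover : ∀ n : ℕ, ∀ z : X, dist z a ∈ Ico r (2 ^ n * r) → ∃ j ∈ Finset.range n, z ∈ S j := by
    intro n
    induction n with
    | zero => intro z hz; simp at hz
    | succ n ih =>
      intro z hz
      by_cases h : dist z a < 2 ^ n * r
      · obtain ⟨j, hj, hzj⟩ := ih z ⟨hz.1, h⟩
        exact ⟨j, Finset.mem_range.2 ((Finset.mem_range.1 hj).trans n.lt_succ_self), hzj⟩
      · exact ⟨n, by simp, not_lt.1 h, hz.2⟩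
  calc modulus μ p (crossingCurves a r R) ≤ ∫⁻ z, η (dist z a) ^ p ∂μ := modulus_le hadm
    _ ≤ ∫⁻ z, ∑ j ∈ Finset.range N, (S j).indicator
          (fun _ => ENNReal.ofReal (c⁻¹ * (2 ^ j * r)⁻¹) ^ p) z ∂μ := by
        refine lintegral_mono fun z => ?_
        by_cases hz : dist z a ∈ Ico r R
        · obtain ⟨j, hj, hzj⟩ := hcover N z hz
          refine le_trans ?_ (Finset.single_le_sum (fun _ _ => zero_le) hj)
          rw [hη, indicator_of_mem hz, indicator_of_mem hzj]
          have hpos : 0 < 2 ^ j * r := by positivity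
          have := hzj.1
          gcongr
        · rw [hη, indicator_of_notMem hz, ENNReal.zero_rpow_of_pos hp]
          exact zero_le
    _ = ∑ j ∈ Finset.range N, ENNReal.ofReal (c⁻¹ * (2 ^ j * r)⁻¹) ^ p * μ (S j) := by
        rw [lintegral_finsetSum _ fun j _ => measurable_const.indicator (hSm j)]
        exact Finset.sum_congr rfl fun j _ => lintegral_indicator_const (hSm j) _
    _ ≤ ∑ j ∈ Finset.range N, ENNReal.ofReal (C * (2 / c) ^ p) := by
        refine Finset.sum_le_sum fun j _ => ?_
        have hpos : 0 < 2 ^ j * r := by positivity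
        have hball : μ (S j) ≤ ENNReal.ofReal (C * (2 ^ (j + 1) * r) ^ p) :=
          (measure_mono fun z hz => Metric.mem_closedBall.2 hz.2.le).trans
            (hC a _ (by positivity))
        refine (mul_le_mul_right hball _).trans (le_of_eq ?_)
        rw [ENNReal.ofReal_rpow_of_nonneg (by positivity) hp.le,
          ← ENNReal.ofReal_mul (by positivity)]
        congr 1
        rw [mul_left_comm, ← Real.mul_rpow (by positivity) (by positivity)]
        congr 2
        field_simp
        ring
    _ = ENNReal.ofReal (N * (C * (2 / c) ^ p)) := by
        rw [Finset.sum_const, Finset.card_range, nsmul_eq_mul, ENNReal.ofReal_mul hN'.le,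
          ENNReal.ofReal_natCast]

/-- Rings of large ratio have small modulus, uniformly in the centre and the radius. -/
lemma exists_modulus_crossingCurves_le (hp : 1 < p)
    (hC : ∀ (x : X) (R : ℝ), 0 < R → μ (Metric.closedBall x R) ≤ ENNReal.ofReal (C * R ^ p))
    {ε : ℝ≥0∞} (hε : 0 < ε) :
    ∃ N : ℕ, 0 < N ∧ ∀ (a : X) (r : ℝ), 0 < r →
      modulus μ p (crossingCurves a r (2 ^ N * r)) ≤ ε := by
  have hlog2 : 0 < Real.log 2 := Real.log_pos one_lt_two
  have hlim : Tendsto (fun N : ℕ => (N : ℝ) * (C * (2 / (N * Real.log 2)) ^ p)) atTop (𝓝 0) := by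
    have h1 : Tendsto (fun N : ℕ => C * (2 / Real.log 2) ^ p * (N : ℝ) ^ (-(p - 1))) atTop
        (𝓝 (C * (2 / Real.log 2) ^ p * 0)) :=
      ((tendsto_rpow_neg_atTop (sub_pos.2 hp)).comp tendsto_natCast_atTop_atTop).const_mul _
    rw [mul_zero] at h1
    refine h1.congr' ((eventually_gt_atTop 0).mono fun N hN => ?_)
    have hN' : (0 : ℝ) < N := Nat.cast_pos.2 hN
    simp only
    rw [mul_comm (N : ℝ) (Real.log 2), ← div_div, Real.div_rpow (by positivity) hN'.le, neg_sub,
      Real.rpow_sub hN', Real.rpow_one]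
    ring
  have hlim' := ENNReal.tendsto_ofReal hlim
  rw [ENNReal.ofReal_zero] at hlim'
  obtain ⟨N, hN, hN0⟩ := ((hlim'.eventually_le_const hε).and (eventually_gt_atTop 0)).exists
  exact ⟨N, hN0, fun a r hr =>
    (modulus_crossingCurves_le (zero_lt_one.trans hp) hC a hr hN0).trans hN⟩

end UpperMassBound

/-! ### Lower bounds for the modulus in Loewner spaces -/

section LowerBound

variable {X : Type*} [MetricSpace X]

/-- A path-connected set that crosses a closed ring about `a` contains a continuum that lies in the
ring and connects its two boundary spheres. -/
lemma exists_isContinuum_crossing {E : Set X} (hE : IsPathConnected E) {a x y : X} {u v : ℝ}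
    (huv : u < v) (hx : x ∈ E) (hy : y ∈ E) (hxu : dist x a ≤ u) (hyv : v ≤ dist y a) :
    ∃ K ⊆ E, IsContinuum K ∧ (∀ z ∈ K, u ≤ dist z a ∧ dist z a ≤ v) ∧
      (∃ x' ∈ K, dist x' a = u) ∧ ∃ y' ∈ K, dist y' a = v := by
  obtain ⟨γ, hγ⟩ := hE.joinedIn x hx y hy
  have hcont : ContinuousOn (fun t => dist (γ.extend t) a) (Icc 0 1) :=
    (γ.continuous_extend.dist continuous_const).continuousOn
  obtain ⟨s, t, hs, hst, ht, hsu, htv, hr⟩ := exists_crossing zero_le_one hcont huv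
    (by simpa using hxu) (by simpa using hyv)
  refine ⟨γ.extend '' Icc s t, ?_, ⟨isCompact_Icc.image γ.continuous_extend,
    (isConnected_Icc hst.le).image _ γ.continuous_extend.continuousOn⟩, ?_,
    ⟨_, mem_image_of_mem _ (left_mem_Icc.2 hst.le), hsu⟩,
    ⟨_, mem_image_of_mem _ (right_mem_Icc.2 hst.le), htv⟩⟩
  · rintro _ ⟨r, hr, rfl⟩
    rw [γ.extend_apply ⟨hs.trans hr.1, hr.2.trans ht⟩]
    exact hγ _
  · rintro _ ⟨r, hr', rfl⟩
    rcases hr'.1.eq_or_lt with rfl | h1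
    · exact ⟨hsu.ge, hsu.le.trans huv.le⟩
    rcases hr'.2.eq_or_lt with rfl | h2
    · exact ⟨huv.le.trans htv.ge, htv.le⟩
    exact ⟨(hr r ⟨h1, h2⟩).1.le, (hr r ⟨h1, h2⟩).2.le⟩

variable [MeasurableSpace X] {μ : Measure X} {p : ℝ}

/-- Two disjoint path-connected sets that both cross the closed ring `ρ ≤ dist(·, a) ≤ 2ρ` are
joined by a curve family of modulus at least `φ_p(4)`, since the crossing continua have diameter at
least `ρ` and lie within distance `4ρ` of each other. -/
lemma loewnerFunction_le_of_crossing {E F : Set X} (hE : IsPathConnected E) (hF : IsPathConnected F)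
    (hEF : Disjoint E F) {a x y x' y' : X} {ρ : ℝ} (hρ : 0 < ρ) (hx : x ∈ E) (hy : y ∈ E)
    (hx' : x' ∈ F) (hy' : y' ∈ F) (hxρ : dist x a ≤ ρ) (hyρ : 2 * ρ ≤ dist y a)
    (hxρ' : dist x' a ≤ ρ) (hyρ' : 2 * ρ ≤ dist y' a) :
    loewnerFunction μ p 4 ≤ modulus μ p
      {γ ∈ joiningCurves E F univ | ρ ≤ dist (γ.toFun γ.a) a ∧ dist (γ.toFun γ.a) a ≤ 2 * ρ} := by
  have hlt : ρ < 2 * ρ := by linarith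
  obtain ⟨K, hKE, hK, hKρ, ⟨k₁, hk₁, hk₁ρ⟩, k₂, hk₂, hk₂ρ⟩ :=
    exists_isContinuum_crossing hE hlt hx hy hxρ hyρ
  obtain ⟨K', hKF, hK', hKρ', ⟨k₁', hk₁', hk₁ρ'⟩, k₂', hk₂', hk₂ρ'⟩ :=
    exists_isContinuum_crossing hF hlt hx' hy' hxρ' hyρ'
  have hdiam : ∀ {S : Set X} {s₁ s₂ : X}, IsContinuum S → s₁ ∈ S → s₂ ∈ S → dist s₁ a = ρ →
      dist s₂ a = 2 * ρ → ρ ≤ Metric.diam S ∧ S.Nontrivial := by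
    intro S s₁ s₂ hS h₁ h₂ h₁ρ h₂ρ
    have hd : ρ ≤ dist s₂ s₁ := by
      have := dist_triangle s₂ s₁ a
      linarith
    exact ⟨hd.trans (Metric.dist_le_diam_of_mem hS.1.isBounded h₂ h₁),
      s₂, h₂, s₁, h₁, dist_pos.1 (hρ.trans_le hd)⟩
  obtain ⟨hd, hnt⟩ := hdiam hK hk₁ hk₂ hk₁ρ hk₂ρ
  obtain ⟨hd', hnt'⟩ := hdiam hK' hk₁' hk₂' hk₁ρ' hk₂ρ'
  have hdist : setDist K K' ≤ 4 * ρ := by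
    refine (csInf_le ⟨0, ?_⟩ (mem_image2_of_mem hk₁ hk₁')).trans ?_
    · rintro _ ⟨z, _, w, _, rfl⟩
      exact dist_nonneg
    · have := dist_triangle_right k₁ k₁' a
      linarith
  have hmin : ρ ≤ min (Metric.diam K) (Metric.diam K') := le_min hd hd'
  have hrel : relDist K K' ≤ 4 := by
    rw [relDist, div_le_iff₀ (hρ.trans_le hmin)]
    linarith
  have hle : loewnerFunction μ p 4 ≤ modulus μ p (joiningCurves K K' univ) :=
    sInf_le ⟨K, K', hK, hnt, hK', hnt', hEF.mono hKE hKF, hrel, rfl⟩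
  refine hle.trans (modulus_mono ?_)
  rintro γ ⟨ha, hb, hu⟩
  exact ⟨⟨hKE ha, hKF hb, hu⟩, hKρ _ ha⟩

variable [BorelSpace X] {C : ℝ}

/-- In a Loewner space with the upper mass bound, the modulus of the curves joining two disjoint
path-connected sets of size at least `δ` tends to infinity as the sets approach each other. At every
one of the many scales between the distance of the sets and `δ`, the Loewner property provides
curves of modulus bounded below; by the upper mass bound most of them stay in a ring of that scale,
and the contributions of disjoint rings add up. -/
theorem IsLoewner.exists_lt_modulus (hL : IsLoewner μ p) (hp : 1 < p)
    (hC : ∀ (x : X) (R : ℝ), 0 < R → μ (Metric.closedBall x R) ≤ ENNReal.ofReal (C * R ^ p))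
    {δ : ℝ} (hδ : 0 < δ) {M : ℝ≥0∞} (hM : M ≠ ⊤) :
    ∃ t > 0, ∀ E F : Set X, IsPathConnected E → IsPathConnected F → Disjoint E F →
      ∀ a ∈ E, ∀ b ∈ F, dist b a < t → (∃ y ∈ E, δ ≤ dist y a) → (∃ y ∈ F, δ ≤ dist y a) →
      M < modulus μ p (joiningCurves E F univ) := by
  set c := min (loewnerFunction μ p 4) 1 with hc
  have hc0 : 0 < c := lt_min (hL 4 (by norm_num)) one_pos
  have hctop : c ≠ ⊤ := ne_top_of_le_ne_top ENNReal.one_ne_top (min_le_right _ _)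
  obtain ⟨N, -, hN⟩ := exists_modulus_crossingCurves_le hp hC
    (ENNReal.half_pos (ENNReal.half_pos hc0.ne').ne')
  -- each ring of the scales below contributes at least `c / 2`, so `J` of them suffice
  obtain ⟨J, hJ⟩ := ENNReal.exists_nat_mul_gt (ENNReal.half_pos hc0.ne').ne' hM
  set T : ℝ := 2 ^ N with hT
  have hT1 : 1 ≤ T := one_le_pow₀ one_le_two
  have hT0 : 0 < T := one_pos.trans_le hT1
  -- the least ratio of scales for which the rings `ρ / T < dist(·, a) < 2 T ρ` are disjoint
  set Λ : ℝ := 2 * T ^ 2 with hΛ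
  have hΛ1 : 1 ≤ Λ := by nlinarith
  have hΛ0 : 0 < Λ := one_pos.trans_le hΛ1
  refine ⟨δ / (2 * Λ ^ J), by positivity, ?_⟩
  set s := δ / (2 * Λ ^ J) with hs
  have hs0 : 0 < s := by positivity
  intro E F hE hF hEF a ha b hb hba ⟨y, hy, hyδ⟩ ⟨y', hy', hyδ'⟩
  -- the scales, and the rings around them
  set ρ : ℕ → ℝ := fun j => Λ ^ j * s with hρ
  have hρ0 : ∀ j, 0 < ρ j := fun j => by positivity
  set A : ℕ → Set X := fun j => {x | ρ j / T < dist x a ∧ dist x a < T * (2 * ρ j)} with hA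
  set Δ : ℕ → Set (Curve X) := fun j => {γ ∈ joiningCurves E F univ | γ.carrier ⊆ A j} with hΔ
  have hAm : ∀ j, MeasurableSet (A j) := fun j =>
    (continuous_id.dist continuous_const).measurable measurableSet_Ioo
  have hAlt : ∀ i j, i < j → Disjoint (A i) (A j) := by
    intro i j hij
    refine Set.disjoint_left.2 fun x hxi hxj => ?_
    have h1 : Λ ^ (i + 1) ≤ Λ ^ j := pow_le_pow_right₀ hΛ1 hij
    have h2 : T * (2 * ρ i) ≤ ρ j / T := by
      rw [le_div_iff₀ hT0]
      calc T * (2 * ρ i) * T = Λ ^ (i + 1) * s := by simp only [hρ, hΛ]; ring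
        _ ≤ ρ j := mul_le_mul_of_nonneg_right h1 hs0.le
    exact absurd (hxj.1.trans hxi.2) (not_lt.2 h2)
  have hAdisj : ((Finset.range J : Finset ℕ) : Set ℕ).PairwiseDisjoint A := by
    intro i _ j _ hij
    rcases lt_or_gt_of_ne hij with h | h
    · exact hAlt i j h
    · exact (hAlt j i h).symm
  have hkey : ∀ j ∈ Finset.range J, c / 2 ≤ modulus μ p (Δ j) := by
    intro j hj
    have hsρ : s ≤ ρ j := le_mul_of_one_le_left hs0.le (one_le_pow₀ hΛ1)
    have hρδ : 2 * ρ j ≤ δ := by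
      have h1 : Λ ^ j ≤ Λ ^ J := pow_le_pow_right₀ hΛ1 (Finset.mem_range.1 hj).le
      calc 2 * ρ j ≤ 2 * (Λ ^ J * s) := by simp only [hρ]; gcongr
        _ = δ := by rw [hs]; field_simp
    have h1 : c ≤ _ := (min_le_left _ _).trans (loewnerFunction_le_of_crossing (μ := μ) (p := p)
      hE hF hEF (hρ0 j) ha hy hb hy' (by rw [dist_self]; exact (hρ0 j).le) (hρδ.trans hyδ)
      (hba.le.trans hsρ) (hρδ.trans hyδ'))
    have h2 : {γ ∈ joiningCurves E F univ | ρ j ≤ dist (γ.toFun γ.a) a ∧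
        dist (γ.toFun γ.a) a ≤ 2 * ρ j} ⊆ Δ j ∪ (crossingCurves a (ρ j / T) (T * (ρ j / T)) ∪
          crossingCurves a (2 * ρ j) (T * (2 * ρ j))) := by
      rintro γ ⟨hγ, hγ1, hγ2⟩
      have hγa : γ.toFun γ.a ∈ γ.carrier := mem_image_of_mem _ γ.left_mem
      -- a curve starting in `ρ ≤ dist(·, a) ≤ 2ρ` stays in `A j` or crosses one of two wide rings
      by_cases hin : ∃ x ∈ γ.carrier, dist x a ≤ ρ j / T
      · exact Or.inr (Or.inl ⟨hin, _, hγa, by rwa [mul_div_cancel₀ _ hT0.ne']⟩)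
      by_cases hout : ∃ x ∈ γ.carrier, T * (2 * ρ j) ≤ dist x a
      · exact Or.inr (Or.inr ⟨⟨_, hγa, hγ2⟩, hout⟩)
      push Not at hin hout
      exact Or.inl ⟨hγ, fun x hx => ⟨hin x hx, hout x hx⟩⟩
    have h3 : c ≤ modulus μ p (Δ j) + c / 2 := by
      refine (h1.trans (modulus_mono h2)).trans (modulus_union_le.trans (add_le_add le_rfl ?_))
      refine modulus_union_le.trans ?_
      rw [← ENNReal.add_halves (c / 2)]
      exact add_le_add (hN a _ (div_pos (hρ0 j) hT0)) (hN a _ (mul_pos two_pos (hρ0 j)))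
    rw [← ENNReal.sub_half hctop]
    exact tsub_le_iff_right.2 h3
  calc M < J * (c / 2) := hJ
    _ = ∑ j ∈ Finset.range J, c / 2 := by rw [Finset.sum_const, Finset.card_range, nsmul_eq_mul]
    _ ≤ ∑ j ∈ Finset.range J, modulus μ p (Δ j) := Finset.sum_le_sum hkey
    _ ≤ modulus μ p (joiningCurves E F univ) :=
        sum_modulus_le (one_pos.trans hp) _ (fun j _ => hAm j) hAdisj (fun j _ => sep_subset _ _)
          fun j _ γ hγ => hγ.2

end LowerBound

/-! ### Upper bounds from the ring inequality -/

section Subcurve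

variable {X X' : Type*} [MetricSpace X] [MetricSpace X'] {D : Set X} {D' : Set X'}

/-- A curve in `D'` whose preimage leads from the ball `B(c, r)` to the complement of `B(c, R)`
has a subcurve that is the image of a curve crossing the ring. -/
lemma exists_restrict_mem_imageFamily (f : D ≃ₜ D') (β : Curve X')
    (hβ : ∀ t ∈ Icc β.a β.b, β.toFun t ∈ D') {c : X} {r R : ℝ} (hrR : r < R)
    (ha : dist (f.symm ⟨β.toFun β.a, hβ _ β.left_mem⟩ : X) c ≤ r)
    (hb : R ≤ dist (f.symm ⟨β.toFun β.b, hβ _ β.right_mem⟩ : X) c) :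
    ∃ (s t : ℝ) (hs : s ∈ Icc β.a β.b) (ht : t ∈ Icc β.a β.b) (hst : s < t),
      β.restrict hs ht hst ∈ imageFamily (fun x : D => (f x : X'))
        (joiningCurves (Metric.sphere c r) (Metric.sphere c R) (ring c r R ∩ D)) := by
  classical
  -- the preimage curve; the value `c` where `β` is outside `D'` is arbitrary
  set γ : ℝ → X := fun t => if h : β.toFun t ∈ D' then (f.symm ⟨β.toFun t, h⟩ : X) else c with hγ
  have hγ_eq : ∀ t (ht : t ∈ Icc β.a β.b), γ t = f.symm ⟨β.toFun t, hβ t ht⟩ := fun t ht =>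
    dif_pos (hβ t ht)
  have hcont : ContinuousOn γ (Icc β.a β.b) := by
    rw [continuousOn_iff_continuous_domRestrict]
    have : (Icc β.a β.b).domRestrict γ =
        fun t : Icc β.a β.b => (f.symm ⟨β.toFun t, hβ t t.2⟩ : X) :=
      funext fun t => hγ_eq t t.2
    rw [this]
    exact continuous_subtype_val.comp (f.symm.continuous.comp
      ((continuousOn_iff_continuous_domRestrict.1 β.cont).subtype_mk _))
  have hdist : ContinuousOn (fun t => dist (γ t) c) (Icc β.a β.b) :=
    (continuous_id.dist continuous_const).comp_continuousOn hcont
  obtain ⟨s, t, hs, hst, ht, hsr, htR, hmid⟩ := exists_crossing β.lt.le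
    hdist hrR
    (by rwa [hγ_eq _ β.left_mem]) (by rwa [hγ_eq _ β.right_mem])
  have hsub : Icc s t ⊆ Icc β.a β.b := Icc_subset_Icc hs ht
  have hs' : s ∈ Icc β.a β.b := hsub (left_mem_Icc.2 hst.le)
  have ht' : t ∈ Icc β.a β.b := hsub (right_mem_Icc.2 hst.le)
  have hγD : ∀ q ∈ Icc s t, γ q ∈ D := fun q hq => by
    rw [hγ_eq q (hsub hq)]
    exact Subtype.coe_prop _
  refine ⟨s, t, hs', ht', hst, ⟨s, t, hst, γ, hcont.mono hsub⟩,
    ⟨hsr, htR, fun q hq => ⟨hmid q hq, hγD q (Ioo_subset_Icc_self hq)⟩⟩, rfl, rfl, fun q hq => ?_⟩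
  refine ⟨hγD q hq, ?_⟩
  have : (⟨γ q, hγD q hq⟩ : D) = f.symm ⟨β.toFun q, hβ q (hsub hq)⟩ :=
    Subtype.ext (hγ_eq q (hsub hq))
  simp only [this, Homeomorph.apply_symm_apply]
  rfl

end Subcurve

section UpperBound

variable {X X' : Type*} [MetricSpace X] [MeasurableSpace X] [MetricSpace X'] [MeasurableSpace X']
  {μ : Measure X} {μ' : Measure X'} {α α' : ℝ} {D : Set X} {D' : Set X'} {Q : X → ℝ≥0∞}

/-- The ring inequality with a constant density `η`. -/
lemma RingInequality.modulus_le {f : D → X'} {c : X} {r R : ℝ}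
    (h : RingInequality μ μ' α α' f Q c r R) (hα : 0 ≤ α) (hrR : r < R) :
    modulus μ' α' (imageFamily f (joiningCurves (Metric.sphere c r) (Metric.sphere c R)
      (ring c r R ∩ D))) ≤ (∫⁻ x in D, Q x ∂μ) * ENNReal.ofReal (R - r)⁻¹ ^ α := by
  have hpos : 0 < R - r := sub_pos.2 hrR
  refine (h (fun _ => ENNReal.ofReal (R - r)⁻¹) measurable_const ?_).trans ?_
  · rw [setLIntegral_const, Real.volume_Ioo, ← ENNReal.ofReal_mul (by positivity),
      inv_mul_cancel₀ hpos.ne', ENNReal.ofReal_one]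
  · rw [lintegral_mul_const' _ _ (ENNReal.rpow_ne_top_of_nonneg hα ENNReal.ofReal_ne_top)]
    exact mul_le_mul_left (lintegral_mono_set inter_subset_right) _

/-- Around every point of `closure D` there are arbitrarily small rings for which the ring
inequality is available to all ring `Q`-homeomorphisms. -/
lemma exists_ring_modulus_le (hα : 0 ≤ α) (hD : IsOpen D) (hfr : (frontier D).Nonempty)
    (hQ : ∫⁻ x in D, Q x ∂μ ≠ ⊤) {c : X} (hc : c ∈ closure D) {R₀ : ℝ} (hR₀ : 0 < R₀) :
    ∃ (r R : ℝ) (M : ℝ≥0∞), 0 < r ∧ r < R ∧ R ≤ R₀ ∧ M ≠ ⊤ ∧ ∀ f : D ≃ₜ D',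
      IsRingHomeo μ μ' α α' Q f → modulus μ' α' (imageFamily (fun x : D => (f x : X'))
        (joiningCurves (Metric.sphere c r) (Metric.sphere c R) (ring c r R ∩ D))) ≤ M := by
  -- the restriction `R < dist(c, ∂D)` applies to interior centres only
  obtain ⟨R, hR0, hRR₀, hR⟩ : ∃ R, 0 < R ∧ R ≤ R₀ ∧
      (c ∈ D → R < Metric.infDist c (frontier D)) := by
    by_cases hcD : c ∈ D
    · have hpos : 0 < Metric.infDist c (frontier D) :=
        (isClosed_frontier.notMem_iff_infDist_pos hfr).1 fun h => by
          rw [hD.frontier_eq] at h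
          exact h.2 hcD
      refine ⟨min R₀ (Metric.infDist c (frontier D) / 2), by positivity,
        min_le_left _ _, fun _ => ?_⟩
      exact (min_le_right _ _).trans_lt (half_lt_self hpos)
    · exact ⟨R₀, hR₀, le_rfl, fun h => absurd h hcD⟩
  refine ⟨R / 2, R, (∫⁻ x in D, Q x ∂μ) * ENNReal.ofReal (R - R / 2)⁻¹ ^ α, half_pos hR0,
    half_lt_self hR0, hRR₀, ENNReal.mul_ne_top hQ
      (ENNReal.rpow_ne_top_of_nonneg hα ENNReal.ofReal_ne_top), fun f hf => ?_⟩
  refine RingInequality.modulus_le ?_ hα (half_lt_self hR0)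
  by_cases hcD : c ∈ D
  · exact hf.1 c hcD _ _ (half_pos hR0) (half_lt_self hR0) (hR hcD)
  · refine hf.2 c ?_ _ _ (half_pos hR0) (half_lt_self hR0)
    rw [hD.frontier_eq]
    exact ⟨hc, hcD⟩

/-- For sets `E`, `F` in `D` that lie in two fixed disjoint closed sets `N₁`, `N₂`, the first one a
compact subset of `closure D`, the families joining the images of `E` and `F` have bounded modulus:
`N₁` is covered by the inner balls of finitely many rings whose outer balls miss `N₂`. -/
theorem exists_modulus_image_le (hα : 0 ≤ α) (hD : IsOpen D) (hfr : (frontier D).Nonempty)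
    (hα' : 0 < α') (hQ : ∫⁻ x in D, Q x ∂μ ≠ ⊤) {N₁ N₂ : Set X} (hN₁ : IsCompact N₁)
    (hN₁D : N₁ ⊆ closure D) (hN₂ : IsClosed N₂) (hdisj : Disjoint N₁ N₂) :
    ∃ M : ℝ≥0∞, M ≠ ⊤ ∧ ∀ f : D ≃ₜ D', IsRingHomeo μ μ' α α' Q f → ∀ E F : Set D,
      (∀ x ∈ E, (x : X) ∈ N₁) → (∀ x ∈ F, (x : X) ∈ N₂) →
      modulus μ' α' (joiningCurves ((fun x : D => (f x : X')) '' E) ((fun x : D => (f x : X')) '' F)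
        D') ≤ M := by
  have hball : ∀ c ∈ N₁, ∃ R₀ > 0, Disjoint (Metric.ball c R₀) N₂ := by
    intro c hc
    obtain ⟨R₀, hR₀, h⟩ := Metric.isOpen_iff.1 hN₂.isOpen_compl c (Set.disjoint_left.1 hdisj hc)
    exact ⟨R₀, hR₀, Set.disjoint_left.2 h⟩
  have hring : ∀ c ∈ N₁, ∃ (r R : ℝ) (M : ℝ≥0∞), 0 < r ∧ r < R ∧ Disjoint (Metric.ball c R) N₂ ∧
      M ≠ ⊤ ∧ ∀ f : D ≃ₜ D', IsRingHomeo μ μ' α α' Q f →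
        modulus μ' α' (imageFamily (fun x : D => (f x : X'))
        (joiningCurves (Metric.sphere c r) (Metric.sphere c R) (ring c r R ∩ D))) ≤ M := by
    intro c hc
    obtain ⟨R₀, hR₀, h⟩ := hball c hc
    obtain ⟨r, R, M, hr, hrR, hR, hM, hf⟩ := exists_ring_modulus_le (μ := μ) (μ' := μ') (α' := α')
      (D' := D') hα hD hfr hQ (hN₁D hc) hR₀
    exact ⟨r, R, M, hr, hrR, h.mono_left (Metric.ball_subset_ball hR), hM, hf⟩
  choose! r R M hr hrR hRN hM hf using hring
  obtain ⟨T, hTN, hcov⟩ := hN₁.elim_nhds_subcover (fun c => Metric.ball c (r c))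
    fun c hc => Metric.ball_mem_nhds c (hr c hc)
  refine ⟨∑ c ∈ T, M c, ENNReal.sum_ne_top.2 fun c hc => hM c (hTN c hc), ?_⟩
  intro f hfr E F hE hF
  set I : X → Set (Curve X') := fun c => imageFamily (fun x : D => (f x : X'))
    (joiningCurves (Metric.sphere c (r c)) (Metric.sphere c (R c)) (ring c (r c) (R c) ∩ D)) with hI
  set Γ : X → Set (Curve X') := fun c => {β | ∃ (s t : ℝ) (hs : s ∈ Icc β.a β.b)
    (ht : t ∈ Icc β.a β.b) (hst : s < t), β.restrict hs ht hst ∈ I c} with hΓ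
  have hsub : joiningCurves ((fun x : D => (f x : X')) '' E) ((fun x : D => (f x : X')) '' F) D' ⊆
      ⋃ c ∈ T, Γ c := by
    rintro β ⟨⟨x, hx, hxa⟩, ⟨y, hy, hyb⟩, hβ⟩
    have hβ' : ∀ t ∈ Icc β.a β.b, β.toFun t ∈ D' := by
      intro t ht
      rcases ht.1.eq_or_lt with rfl | h1
      · rw [← hxa]
        exact Subtype.coe_prop _
      rcases ht.2.eq_or_lt with rfl | h2
      · rw [← hyb]
        exact Subtype.coe_prop _
      exact hβ t ⟨h1, h2⟩
    have hxa' : f.symm ⟨β.toFun β.a, hβ' _ β.left_mem⟩ = x := by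
      rw [Homeomorph.symm_apply_eq]
      exact Subtype.ext hxa.symm
    have hyb' : f.symm ⟨β.toFun β.b, hβ' _ β.right_mem⟩ = y := by
      rw [Homeomorph.symm_apply_eq]
      exact Subtype.ext hyb.symm
    obtain ⟨c, hcT, hxc⟩ := mem_iUnion₂.1 (hcov (hE x hx))
    have hcN := hTN c hcT
    refine mem_iUnion₂.2 ⟨c, hcT, exists_restrict_mem_imageFamily f β hβ' (hrR c hcN) ?_ ?_⟩
    · rw [hxa']
      exact (Metric.mem_ball.1 hxc).le
    · rw [hyb']
      exact not_lt.1 fun h => Set.disjoint_left.1 (hRN c hcN) (Metric.mem_ball.2 h) (hF y hy)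
  refine (modulus_mono hsub).trans ((modulus_biUnion_le hα' T Γ).trans
    (Finset.sum_le_sum fun c hc => ?_))
  exact (modulus_le_of_restrict_mem fun β hβ => hβ).trans (hf c (hTN c hc) f hfr)

end UpperBound

/-! ### Joining points by compact path-connected sets -/

section JoiningContinua

variable {X : Type*} [MetricSpace X] {D : Set X}

/-- If `γ` leads from `A` to `B` in `D` and `D` is locally path-connected at `B`, then every point
of `D` near `B` is joined to `A` by a compact path-connected subset of `D` near `γ`: follow `γ`
until it is near `B` and go on in a small path-connected part of `D`. -/
lemma exists_isPathConnected_near_curve {A B : X} (hA : A ∈ D) {γ : Curve X}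
    (hγ : γ ∈ joiningCurves {A} {B} D) (hloc : LocPathConnectedAt D B) {ε : ℝ} (hε : 0 < ε) :
    ∃ U ∈ 𝓝 B, ∀ u ∈ U ∩ D, ∃ E ⊆ D, IsCompact E ∧ IsPathConnected E ∧ A ∈ E ∧ u ∈ E ∧
      E ⊆ Metric.thickening ε γ.carrier := by
  obtain ⟨hγa, hγb, hγD⟩ := hγ
  have hγa' : γ.toFun γ.a = A := hγa
  have hγb' : γ.toFun γ.b = B := hγb
  obtain ⟨V, hV, hVε, hVD⟩ := hloc _ (Metric.ball_mem_nhds B hε)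
  refine ⟨V, hV, fun u hu => ?_⟩
  have hBc : B ∈ γ.carrier := ⟨γ.b, γ.right_mem, hγb'⟩
  have htend : Tendsto γ.toFun (𝓝[Ioo γ.a γ.b] γ.b) (𝓝 B) := by
    have := (γ.cont γ.b γ.right_mem).mono Ioo_subset_Icc_self
    rwa [ContinuousWithinAt, hγb'] at this
  have : (𝓝[Ioo γ.a γ.b] γ.b).NeBot := by
    rw [nhdsWithin_Ioo_eq_nhdsLT γ.lt]
    infer_instance
  obtain ⟨t, htV, ht⟩ := ((htend.eventually hV).and self_mem_nhdsWithin).exists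
  have hsub : Icc γ.a t ⊆ Icc γ.a γ.b := Icc_subset_Icc le_rfl ht.2.le
  have ht' : t ∈ Icc γ.a t := right_mem_Icc.2 ht.1.le
  obtain ⟨q, hq⟩ := hVD.joinedIn (γ.toFun t) ⟨htV, hγD t ht⟩ u hu
  have hqV : range q ⊆ V ∩ D := by
    rintro _ ⟨s, rfl⟩
    exact hq s
  have hcont : ContinuousOn γ.toFun (Icc γ.a t) := γ.cont.mono hsub
  refine ⟨γ.toFun '' Icc γ.a t ∪ range q, ?_, (isCompact_Icc.image_of_continuousOn hcont).union
    (isCompact_range q.continuous), ?_, Or.inl ⟨γ.a, left_mem_Icc.2 ht.1.le, hγa'⟩,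
    Or.inr ⟨1, q.target⟩, ?_⟩
  · rintro x (⟨s, hs, rfl⟩ | hx)
    · rcases hs.1.eq_or_lt with rfl | h
      · rwa [hγa']
      · exact hγD s ⟨h, hs.2.trans_lt ht.2⟩
    · exact (hqV hx).2
  · have hq' : IsPathConnected (range q) := by
      rw [← q.extend_range]
      exact isPathConnected_range q.continuous_extend
    refine IsPathConnected.union ?_ hq'
      ⟨γ.toFun t, ⟨t, ht', rfl⟩, 0, q.source⟩
    exact ((convex_Icc γ.a t).isPathConnected ⟨t, ht'⟩).image' hcont
  · rintro x (⟨s, hs, rfl⟩ | hx)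
    · exact Metric.self_subset_thickening hε _ (mem_image_of_mem _ (hsub hs))
    · exact Metric.mem_thickening_iff.2 ⟨B, hBc, hVε (hqV hx).1⟩

end JoiningContinua

/-! ### Equicontinuity of the inverse maps in the domain -/

section Homeomorph

variable {X X' : Type*} [MetricSpace X] [MetricSpace X'] {D : Set X} {D' : Set X'}

/-- If `D` is open with compact closure, then every point of a homeomorphic copy `D'` has a compact
neighbourhood in `D'`, since `D` is locally compact. -/
lemma exists_isCompact_mem_nhds (hD : IsOpen D) (hcomp : IsCompact (closure D)) (f : D ≃ₜ D')
    (y : D') : ∃ K : Set D', IsCompact K ∧ K ∈ 𝓝 y := by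
  obtain ⟨r, hr, hrD⟩ := Metric.nhds_basis_closedBall.mem_iff.1 (hD.mem_nhds (f.symm y).2)
  have hc : IsCompact (Metric.closedBall (f.symm y : X) r) :=
    hcomp.of_isClosed_subset Metric.isClosed_closedBall (hrD.trans subset_closure)
  refine ⟨f '' ((↑) ⁻¹' Metric.closedBall (f.symm y : X) r), IsCompact.image ?_ f.continuous, ?_⟩
  · rwa [Subtype.isCompact_iff, Subtype.image_preimage_coe, inter_eq_right.2 hrD]
  · have := f.isOpenMap.image_mem_nhds (x := f.symm y) (continuous_subtype_val.continuousAt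
      (Metric.closedBall_mem_nhds (f.symm y : X) hr))
    rwa [f.apply_symm_apply] at this

end Homeomorph

section Equicontinuity

variable {X X' : Type*} [MetricSpace X] [MeasurableSpace X] [MetricSpace X'] [MeasurableSpace X']
  {μ : Measure X} {μ' : Measure X'} {α α' : ℝ} {D : Set X} {D' : Set X'} {Q : X → ℝ≥0∞}

/-- The assumptions on the two spaces, the two domains and the weight `Q` under which the inverses
of normalized ring `Q`-homeomorphisms `D → D'` are equicontinuous. -/
structure InverseSetting (μ : Measure X) (μ' : Measure X') (α α' : ℝ) (D : Set X) (D' : Set X')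
    (Q : X → ℝ≥0∞) : Prop where
  nonneg : 0 ≤ α
  one_lt : 1 < α'
  isOpen : IsOpen D
  isCompact_closure : IsCompact (closure D)
  nontrivial_frontier : (frontier D).Nontrivial
  locPathConnectedAt : ∀ x ∈ closure D, LocPathConnectedAt D x
  disjointlyJoinable : DisjointlyJoinable D
  lintegral_ne_top : ∫⁻ x in D, Q x ∂μ ≠ ⊤
  isLoewner : IsLoewner μ' α'
  upperMassBound : ∃ C : ℝ, ∀ (x : X') (R : ℝ), 0 < R →
    μ' (Metric.closedBall x R) ≤ ENNReal.ofReal (C * R ^ α')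
  isQEDClosure : IsQEDClosure μ' α' D'

/-- The points of `D` near `B` and near `F` are joined to `A` and to `C` by disjoint compact
path-connected sets, and the modulus of the curves joining the images of these sets is bounded
independently of the points and of the ring `Q`-homeomorphism. -/
lemma InverseSetting.exists_modulus_le (S : InverseSetting μ μ' α α' D D' Q) (A C : D) {B F : X}
    (hB : B ∈ closure D) (hF : F ∈ closure D)
    (hdisj : Disjoint ({(A : X), B} : Set X) {(C : X), F}) :
    ∃ U ∈ 𝓝 B, ∃ W ∈ 𝓝 F, ∃ M : ℝ≥0∞, M ≠ ⊤ ∧ ∀ u w : D, (u : X) ∈ U → (w : X) ∈ W →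
      ∃ E G : Set D, IsCompact E ∧ IsPathConnected E ∧ {A, u} ⊆ E ∧ IsCompact G ∧
        IsPathConnected G ∧ {C, w} ⊆ G ∧ Disjoint E G ∧ ∀ f : D ≃ₜ D',
        IsRingHomeo μ μ' α α' Q f → modulus μ' α' (joiningCurves
          ((fun x : D => (f x : X')) '' E) ((fun x : D => (f x : X')) '' G) D') ≤ M := by
  obtain ⟨γ₁, hγ₁, γ₂, hγ₂, hγ⟩ := S.disjointlyJoinable A A.2 B hB C C.2 F hF hdisj
  obtain ⟨ε, hε, hth⟩ := hγ.exists_cthickenings γ₁.isCompact_carrier γ₂.isCompact_carrier.isClosed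
  obtain ⟨U, hU, hUE⟩ := exists_isPathConnected_near_curve A.2 hγ₁ (S.locPathConnectedAt B hB) hε
  obtain ⟨W, hW, hWG⟩ := exists_isPathConnected_near_curve C.2 hγ₂ (S.locPathConnectedAt F hF) hε
  obtain ⟨M, hM, hMf⟩ := exists_modulus_image_le (μ := μ) (μ' := μ') (D' := D') S.nonneg S.isOpen
    S.nontrivial_frontier.nonempty (one_pos.trans S.one_lt) S.lintegral_ne_top
    (S.isCompact_closure.inter_left (Metric.isClosed_cthickening (δ := ε) (E := γ₁.carrier)))
    inter_subset_right (Metric.isClosed_cthickening (δ := ε) (E := γ₂.carrier))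
    (hth.mono_left inter_subset_left)
  have hpull : ∀ {E : Set X}, E ⊆ D → IsCompact E → IsPathConnected E →
      IsCompact ((↑) ⁻¹' E : Set D) ∧ IsPathConnected ((↑) ⁻¹' E : Set D) := by
    intro E hED hE hE'
    have himage : ((↑) : D → X) '' ((↑) ⁻¹' E) = E := by
      rw [Subtype.image_preimage_coe, inter_eq_right.2 hED]
    constructor
    · rwa [Subtype.isCompact_iff, himage]
    · rwa [IsInducing.subtypeVal.isPathConnected_iff, himage]
  refine ⟨U, hU, W, hW, M, hM, fun u w hu hw => ?_⟩
  obtain ⟨E, hED, hEc, hEp, hAE, huE, hEth⟩ := hUE u ⟨hu, u.2⟩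
  obtain ⟨G, hGD, hGc, hGp, hCG, hwG, hGth⟩ := hWG w ⟨hw, w.2⟩
  have hE' : E ⊆ Metric.cthickening ε γ₁.carrier :=
    hEth.trans (Metric.thickening_subset_cthickening _ _)
  have hG' : G ⊆ Metric.cthickening ε γ₂.carrier :=
    hGth.trans (Metric.thickening_subset_cthickening _ _)
  refine ⟨Subtype.val ⁻¹' E, Subtype.val ⁻¹' G, (hpull hED hEc hEp).1, (hpull hED hEc hEp).2,
    insert_subset hAE (singleton_subset_iff.2 huE), (hpull hGD hGc hGp).1, (hpull hGD hGc hGp).2,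
    insert_subset hCG (singleton_subset_iff.2 hwG), (hth.mono hE' hG').preimage _,
    fun f hf => hMf f hf _ _ (fun x hx => ⟨hE' hx, subset_closure x.2⟩) fun x hx => hG' hx⟩

variable [BorelSpace X']

/-- For a ring `Q`-homeomorphism `f`, it is impossible that both the pairs `{A, u}` and `{C, w}`,
with `u` near `B` and `w` near `F`, have one image point very close to `z'` and one far from `z'`:
the images of the joining sets would be large and close to each other, so that the modulus of the
curves joining them would be large. -/
lemma InverseSetting.exists_separation (S : InverseSetting μ μ' α α' D D' Q) (A C : D) {B F : X}
    (hB : B ∈ closure D) (hF : F ∈ closure D)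
    (hdisj : Disjoint ({(A : X), B} : Set X) {(C : X), F})
    (z' : X') {δ : ℝ} (hδ : 0 < δ) :
    ∃ U ∈ 𝓝 B, ∃ W ∈ 𝓝 F, ∃ t > 0, ∀ f : D ≃ₜ D', IsRingHomeo μ μ' α α' Q f → ∀ u w : D,
      (u : X) ∈ U → (w : X) ∈ W → ∀ a ∈ ({A, u} : Set D), ∀ a' ∈ ({A, u} : Set D),
      ∀ b ∈ ({C, w} : Set D), ∀ b' ∈ ({C, w} : Set D), dist (f a : X') z' < t →
      δ ≤ dist (f a' : X') z' → dist (f b : X') z' < t → δ ≤ dist (f b' : X') z' → False := by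
  obtain ⟨U, hU, W, hW, M, hM, hEG⟩ := S.exists_modulus_le A C hB hF hdisj
  obtain ⟨K, -, hK⟩ := S.isQEDClosure
  obtain ⟨c, hc⟩ := S.upperMassBound
  obtain ⟨t, ht, hlow⟩ := S.isLoewner.exists_lt_modulus S.one_lt hc (half_pos hδ)
    (ENNReal.mul_ne_top (ENNReal.coe_ne_top (r := K)) hM)
  refine ⟨U, hU, W, hW, min (δ / 2) (t / 2), by positivity, ?_⟩
  intro f hf u w hu hw a ha a' ha' b hb b' hb' hat hatδ hbt hbtδ
  obtain ⟨E, G, hEc, hEp, hAE, hGc, hGp, hCG, hdEG, hmod⟩ := hEG u w hu hw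
  set φ : D → X' := fun x => (f x : X') with hφ
  have hφc : Continuous φ := continuous_subtype_val.comp f.continuous
  have hφi : Function.Injective φ := Subtype.val_injective.comp f.injective
  have hφD : ∀ T : Set D, φ '' T ⊆ closure D' := by
    rintro T _ ⟨x, _, rfl⟩
    exact subset_closure (f x).2
  have hd : Disjoint (φ '' E) (φ '' G) := (disjoint_image_iff hφi).2 hdEG
  have h1 := hlow (φ '' E) (φ '' G) (hEp.image hφc) (hGp.image hφc) hd
    (φ a) (mem_image_of_mem _ (hAE ha)) (φ b) (mem_image_of_mem _ (hCG hb))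
    (by
      have := dist_triangle_right (φ b) (φ a) z'
      have := hat.trans_le (min_le_right _ _)
      have := hbt.trans_le (min_le_right _ _)
      linarith)
    ⟨φ a', mem_image_of_mem _ (hAE ha'), by
      have := dist_triangle (φ a') (φ a) z'
      have := hat.trans_le (min_le_left _ _)
      linarith⟩
    ⟨φ b', mem_image_of_mem _ (hCG hb'), by
      have := dist_triangle (φ b') (φ a) z'
      have := hat.trans_le (min_le_left _ _)
      linarith⟩
  have h2 := hK (φ '' E) (φ '' G) ⟨hEc.image hφc, (hEp.image hφc).isConnected⟩
    ⟨hGc.image hφc, (hGp.image hφc).isConnected⟩ (hφD E) (hφD G) hd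
  exact absurd (h1.trans_le (h2.trans (mul_le_mul_right (hmod f hf) _))) (lt_irrefl _)

variable {z₀ x₀ : D} {z₀' x₀' : D'}

/-- Away from the two normalization values, distinct limit points cannot both be mapped near `z'`:
one of the two ways of pairing them with `z₀` and `x₀` gives disjoint pairs. -/
lemma InverseSetting.exists_separation_of_ne (S : InverseSetting μ μ' α α' D D' Q) (hzx : z₀ ≠ x₀)
    {z' : X'} (hz' : z' ≠ z₀') (hx' : z' ≠ x₀') {x y : X} (hx : x ∈ closure D) (hy : y ∈ closure D)
    (hxy : x ≠ y) :
    ∃ U ∈ 𝓝 x, ∃ W ∈ 𝓝 y, ∃ t > 0, ∀ f ∈ ringFamily μ μ' α α' z₀ x₀ z₀' x₀' Q, ∀ u w : D,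
      (u : X) ∈ U → (w : X) ∈ W → dist (f u : X') z' < t → dist (f w : X') z' < t → False := by
  have hzx' : (z₀ : X) ≠ x₀ := fun h => hzx (Subtype.ext h)
  set δ := min (dist (z₀' : X') z') (dist (x₀' : X') z')
  have hδ : 0 < δ := lt_min (dist_pos.2 hz'.symm) (dist_pos.2 hx'.symm)
  by_cases hcase : x ≠ x₀ ∧ y ≠ z₀
  · obtain ⟨U, hU, W, hW, t, ht, h⟩ := S.exists_separation z₀ x₀ hx hy (by
      simp only [disjoint_insert_left, disjoint_singleton_left, mem_insert_iff,
        mem_singleton_iff, not_or]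
      exact ⟨⟨hzx', hcase.2.symm⟩, hcase.1, hxy⟩) z' hδ
    refine ⟨U, hU, W, hW, t, ht, fun f hf u w hu hw h1 h2 => ?_⟩
    exact h f hf.1 u w hu hw u (by simp) z₀ (by simp) w (by simp) x₀ (by simp) h1
      (by rw [hf.2.1]; exact min_le_left _ _) h2 (by rw [hf.2.2]; exact min_le_right _ _)
  -- if the pairs `{z₀, x}`, `{x₀, y}` meet, then `x = x₀` or `y = z₀`, and the other pairing is
  -- disjoint
  · have hcase' : x ≠ z₀ ∧ y ≠ x₀ := by
      refine ⟨fun e => hcase ⟨?_, ?_⟩, fun e => hcase ⟨?_, ?_⟩⟩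
      · rwa [e]
      · rw [← e]; exact hxy.symm
      · rwa [← e]
      · rw [e]; exact hzx'.symm
    obtain ⟨U, hU, W, hW, t, ht, h⟩ := S.exists_separation x₀ z₀ hx hy (by
      simp only [disjoint_insert_left, disjoint_singleton_left, mem_insert_iff,
        mem_singleton_iff, not_or]
      exact ⟨⟨hzx'.symm, hcase'.2.symm⟩, hcase'.1, hxy⟩) z' hδ
    refine ⟨U, hU, W, hW, t, ht, fun f hf u w hu hw h1 h2 => ?_⟩
    exact h f hf.1 u w hu hw u (by simp) x₀ (by simp) w (by simp) z₀ (by simp) h1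
      (by rw [hf.2.2]; exact min_le_right _ _) h2 (by rw [hf.2.1]; exact min_le_left _ _)

/-- Only points near `z₀` are mapped near `z₀'`. Near a boundary point of `D` other than `x` there
are points whose images stay out of a fixed compact neighbourhood of `z₀'` in `D'`; such a point is
paired with `z₀`, and `x` with `x₀`. -/
lemma InverseSetting.exists_separation_left (S : InverseSetting μ μ' α α' D D' Q) (hzx : z₀ ≠ x₀)
    (hzx' : z₀' ≠ x₀') {x : X} (hx : x ∈ closure D) (hxz : x ≠ z₀) :
    ∃ W ∈ 𝓝 x, ∃ t > 0, ∀ f ∈ ringFamily μ μ' α α' z₀ x₀ z₀' x₀' Q, ∀ w : D, (w : X) ∈ W →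
      dist (f w : X') z₀' < t → False := by
  -- one member of the family makes `D'` locally compact; the neighbourhood `K` then serves them all
  rcases (ringFamily μ μ' α α' z₀ x₀ z₀' x₀' Q).eq_empty_or_nonempty with hemp | ⟨f₀, -⟩
  · exact ⟨univ, univ_mem, 1, one_pos, by simp [hemp]⟩
  obtain ⟨K, hK, hKz⟩ := exists_isCompact_mem_nhds S.isOpen S.isCompact_closure f₀ z₀'
  obtain ⟨r, hr, hrK⟩ := Metric.mem_nhds_iff.1 hKz
  obtain ⟨q, hq, hqx⟩ := S.nontrivial_frontier.exists_ne x
  have hqcl : q ∈ closure D := hq.1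
  have hqD : ∀ d : D, q ≠ d := by
    rw [S.isOpen.frontier_eq] at hq
    exact fun d e => hq.2 (e ▸ d.2)
  have hpos : 0 < dist (x₀' : X') z₀' := dist_pos.2 fun e => hzx' (Subtype.ext e.symm)
  obtain ⟨U, hU, W, hW, t, ht, h⟩ := S.exists_separation z₀ x₀ hqcl hx (by
      simp only [disjoint_insert_left, disjoint_singleton_left, mem_insert_iff,
        mem_singleton_iff, not_or]
      exact ⟨⟨fun e => hzx (Subtype.ext e), hxz.symm⟩, hqD x₀, hqx⟩) z₀' (lt_min hr hpos)
  refine ⟨W, hW, t, ht, fun f hf w hw hwt => ?_⟩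
  -- a point of `D` near `q` whose image lies outside `K`
  obtain ⟨u, huU, huD, huK⟩ : ∃ u ∈ U, ∃ hu : u ∈ D, f ⟨u, hu⟩ ∉ K := by
    have hcl : IsClosed ((fun y : D' => (f.symm y : X)) '' K) :=
      (hK.image (continuous_subtype_val.comp f.symm.continuous)).isClosed
    have hqK : q ∈ ((fun y : D' => (f.symm y : X)) '' K)ᶜ := by
      rintro ⟨y, _, e⟩
      exact hqD _ e.symm
    obtain ⟨u, ⟨huU, huK⟩, huD⟩ := mem_closure_iff_nhds.1 hqcl _
      (inter_mem hU (hcl.isOpen_compl.mem_nhds hqK))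
    exact ⟨u, huU, huD, fun hmem => huK ⟨_, hmem, by simp⟩⟩
  have hur : r ≤ dist (f ⟨u, huD⟩ : X') z₀' := not_lt.1 fun hlt => huK (hrK hlt)
  exact h f hf.1 ⟨u, huD⟩ w huU hw z₀ (by simp) ⟨u, huD⟩ (by simp) w (by simp) x₀ (by simp)
    (by rw [hf.2.1, dist_self]; exact ht) ((min_le_left _ _).trans hur) hwt
    (by rw [hf.2.2]; exact min_le_right _ _)

/-- Equicontinuity of the inverses at the value `z₀'`; `x₀'` is covered by exchanging the roles of
`z₀` and `x₀`. -/
lemma InverseSetting.exists_dist_lt_left (S : InverseSetting μ μ' α α' D D' Q) (hzx : z₀ ≠ x₀)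
    (hzx' : z₀' ≠ x₀') {ε : ℝ} (hε : 0 < ε) :
    ∃ t > 0, ∀ f ∈ ringFamily μ μ' α α' z₀ x₀ z₀' x₀' Q, ∀ u w : D,
      dist (f u : X') z₀' < t → dist (f w : X') z₀' < t → dist u w < ε := by
  have hcomp : IsCompact (closure D ∩ {x | ε / 2 ≤ dist x z₀}) :=
    S.isCompact_closure.inter_right
      (isClosed_le continuous_const (continuous_id.dist continuous_const))
  obtain ⟨t, ht, h⟩ : ∃ t > 0, ∀ f ∈ ringFamily μ μ' α α' z₀ x₀ z₀' x₀' Q, ∀ u : D,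
      (u : X) ∈ closure D ∩ {x | ε / 2 ≤ dist x z₀} → dist (f u : X') z₀' < t → False := by
    refine hcomp.induction_on (p := fun P => ∃ t > 0,
      ∀ f ∈ ringFamily μ μ' α α' z₀ x₀ z₀' x₀' Q, ∀ u : D, (u : X) ∈ P →
        dist (f u : X') z₀' < t → False) ⟨1, one_pos, by simp⟩ ?_ ?_ ?_
    · rintro P P' hPP' ⟨t, ht, h⟩
      exact ⟨t, ht, fun f hf u hu => h f hf u (hPP' hu)⟩
    · rintro P P' ⟨t, ht, h⟩ ⟨t', ht', h'⟩
      refine ⟨min t t', lt_min ht ht', fun f hf u hu hut => ?_⟩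
      rcases hu with hu | hu
      · exact h f hf u hu (hut.trans_le (min_le_left _ _))
      · exact h' f hf u hu (hut.trans_le (min_le_right _ _))
    · rintro x ⟨hx, hxε⟩
      obtain ⟨W, hW, h⟩ := S.exists_separation_left hzx hzx' hx
        (dist_pos.1 ((half_pos hε).trans_le hxε))
      exact ⟨W, mem_nhdsWithin_of_mem_nhds hW, h⟩
  have hlt : ∀ f ∈ ringFamily μ μ' α α' z₀ x₀ z₀' x₀' Q, ∀ u : D, dist (f u : X') z₀' < t →
      dist (u : X) z₀ < ε / 2 := fun f hf u hut =>
    not_le.1 fun hle => h f hf u ⟨subset_closure u.2, hle⟩ hut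
  refine ⟨t, ht, fun f hf u w hu hw => ?_⟩
  have := dist_triangle_right (u : X) w z₀
  have := hlt f hf u hu
  have := hlt f hf w hw
  rw [Subtype.dist_eq]
  linarith

/-- Uniformly in `f`, points of `D` with images near a given point `z'` are near each other. -/
theorem InverseSetting.exists_dist_lt (S : InverseSetting μ μ' α α' D D' Q) (hzx : z₀ ≠ x₀)
    (hzx' : z₀' ≠ x₀') (z' : X') {ε : ℝ} (hε : 0 < ε) :
    ∃ t > 0, ∀ f ∈ ringFamily μ μ' α α' z₀ x₀ z₀' x₀' Q, ∀ u w : D,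
      dist (f u : X') z' < t → dist (f w : X') z' < t → dist u w < ε := by
  by_cases hz : z' = z₀'
  · rw [hz]
    exact S.exists_dist_lt_left hzx hzx' hε
  by_cases hx : z' = x₀'
  · obtain ⟨t, ht, h⟩ := S.exists_dist_lt_left (z₀ := x₀) (x₀ := z₀) hzx.symm hzx'.symm hε
    rw [hx]
    exact ⟨t, ht, fun f hf => h f ⟨hf.1, hf.2.2, hf.2.1⟩⟩
  have hcomp : IsCompact ((closure D ×ˢ closure D) ∩ {q : X × X | ε ≤ dist q.1 q.2}) :=
    (S.isCompact_closure.prod S.isCompact_closure).inter_right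
      (isClosed_le continuous_const continuous_dist)
  obtain ⟨t, ht, h⟩ : ∃ t > 0, ∀ f ∈ ringFamily μ μ' α α' z₀ x₀ z₀' x₀' Q, ∀ u w : D,
      ((u : X), (w : X)) ∈ (closure D ×ˢ closure D) ∩ {q : X × X | ε ≤ dist q.1 q.2} →
      dist (f u : X') z' < t → dist (f w : X') z' < t → False := by
    refine hcomp.induction_on (p := fun P => ∃ t > 0,
      ∀ f ∈ ringFamily μ μ' α α' z₀ x₀ z₀' x₀' Q, ∀ u w : D, ((u : X), (w : X)) ∈ P →
        dist (f u : X') z' < t → dist (f w : X') z' < t → False) ⟨1, one_pos, by simp⟩ ?_ ?_ ?_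
    · rintro P P' hPP' ⟨t, ht, h⟩
      exact ⟨t, ht, fun f hf u w hu => h f hf u w (hPP' hu)⟩
    · rintro P P' ⟨t, ht, h⟩ ⟨t', ht', h'⟩
      refine ⟨min t t', lt_min ht ht', fun f hf u w hu hut hwt => ?_⟩
      rcases hu with hu | hu
      · exact h f hf u w hu (hut.trans_le (min_le_left _ _)) (hwt.trans_le (min_le_left _ _))
      · exact h' f hf u w hu (hut.trans_le (min_le_right _ _)) (hwt.trans_le (min_le_right _ _))
    · rintro ⟨x, y⟩ ⟨⟨hx', hy'⟩, hxy⟩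
      obtain ⟨U, hU, W, hW, t, ht, h⟩ := S.exists_separation_of_ne hzx hz hx hx' hy'
        (dist_pos.1 (hε.trans_le hxy))
      exact ⟨U ×ˢ W, mem_nhdsWithin_of_mem_nhds (prod_mem_nhds hU hW), t, ht,
        fun f hf u w huw => h f hf u w huw.1 huw.2⟩
  exact ⟨t, ht, fun f hf u w hu hw => not_le.1 fun hle =>
    h f hf u w ⟨⟨subset_closure u.2, subset_closure w.2⟩, hle⟩ hu hw⟩

end Equicontinuity

/-! ### Extension to the closure -/

section Extension

variable {X X' : Type*} [MetricSpace X] [MetricSpace X'] {D : Set X} {D' : Set X'}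

lemma isDenseInducing_inclusion_closure (s : Set X) :
    IsDenseInducing (inclusion (subset_closure : s ⊆ closure s)) :=
  ⟨(IsEmbedding.inclusion subset_closure).isInducing, (denseRange_inclusion_iff _).2 subset_rfl⟩

/-- The values of `f⁻¹` near a point of `closure D'` form a Cauchy filter, which converges as
`closure D` is compact. -/
lemma exists_isExtendedInverse (hcomp : IsCompact (closure D)) (f : D ≃ₜ D')
    (hf : ∀ z' ∈ closure D', ∀ ε > 0, ∃ t > 0, ∀ u w : D, dist (f u : X') z' < t →
      dist (f w : X') z' < t → dist u w < ε) :
    ∃ g : closure D' → closure D, IsExtendedInverse f g := by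
  have di := isDenseInducing_inclusion_closure D'
  have hcs : CompactSpace (closure D) := isCompact_iff_compactSpace.1 hcomp
  set φ : D' → closure D := fun y => inclusion subset_closure (f.symm y) with hφ
  have hφc : Continuous φ := (continuous_inclusion subset_closure).comp f.symm.continuous
  refine ⟨di.extend φ, di.continuous_extend fun z => ?_, fun y => ?_⟩
  · have := di.comap_nhds_neBot z
    refine CompleteSpace.complete (Metric.cauchy_iff.2 ⟨inferInstance, fun ε hε => ?_⟩)
    obtain ⟨t, ht, h⟩ := hf z z.2 ε hε
    refine ⟨φ '' (inclusion subset_closure ⁻¹' Metric.ball z t),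
      image_mem_map (preimage_mem_comap (Metric.ball_mem_nhds z ht)), ?_⟩
    rintro _ ⟨y, hy, rfl⟩ _ ⟨y', hy', rfl⟩
    exact h (f.symm y) (f.symm y') (by rwa [f.apply_symm_apply]) (by rwa [f.apply_symm_apply])
  · exact congrArg Subtype.val (di.extend_eq hφc y)

/-- An oscillation bound for `f⁻¹` on a ball passes to the extension, by density of `D'`. -/
lemma IsExtendedInverse.dist_le {f : D ≃ₜ D'} {g : closure D' → closure D}
    (hg : IsExtendedInverse f g) {z' : X'} {t ε : ℝ}
    (h : ∀ u w : D, dist (f u : X') z' < t → dist (f w : X') z' < t → dist u w < ε)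
    {y z : closure D'} (hy : dist (y : X') z' < t) (hz : dist (z : X') z' < t) :
    dist (g y) (g z) ≤ ε := by
  have di := isDenseInducing_inclusion_closure D'
  have hy' := di.comap_nhds_neBot y
  have hz' := di.comap_nhds_neBot z
  have hnear : ∀ {v : closure D'}, dist (v : X') z' < t →
      ∀ᶠ d : D' in comap (inclusion subset_closure) (𝓝 v), dist (d : X') z' < t := by
    intro v hv
    have hopen : IsOpen {v : closure D' | dist (v : X') z' < t} :=
      isOpen_lt (continuous_subtype_val.dist continuous_const) continuous_const
    exact preimage_mem_comap (hopen.mem_nhds hv)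
  have htend : ∀ v : closure D', Tendsto (fun d : D' => g (inclusion subset_closure d))
      (comap (inclusion subset_closure) (𝓝 v)) (𝓝 (g v)) := fun v =>
    (hg.1.tendsto v).comp tendsto_comap
  refine le_of_tendsto (((htend y).comp tendsto_fst).dist ((htend z).comp tendsto_snd)) ?_
  filter_upwards [prod_mem_prod (hnear hy) (hnear hz)] with d hd
  have e : ∀ d : D', g (inclusion subset_closure d) = inclusion subset_closure (f.symm d) :=
    fun d => Subtype.ext (hg.2 d)
  simp only [Function.comp, e]
  exact (h (f.symm d.1) (f.symm d.2) (by rw [f.apply_symm_apply]; exact hd.1)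
    (by rw [f.apply_symm_apply]; exact hd.2)).le

end Extension

end RingMaps

theorem mainTheorem1 {X X' : Type*}
    [MetricSpace X] [MeasurableSpace X] [BorelSpace X]
    [MetricSpace X'] [MeasurableSpace X'] [BorelSpace X']
    (μ : Measure X) [IsLocallyFiniteMeasure μ] (μ' : Measure X') [IsLocallyFiniteMeasure μ']
    (α α' : ℝ) (hα : 2 ≤ α) (hα' : 2 ≤ α')
    (D : Set X) (D' : Set X')
    (hD_open : IsOpen D) (hD : IsPathConnected D) (hD' : IsPathConnected D')
    (hdim : dimH D = ENNReal.ofReal α) (hdim' : dimH D' = ENNReal.ofReal α')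
    (hLoewner : RingMaps.IsLoewner μ' α')
    (hAhlfors : ∃ C : ℝ, 1 ≤ C ∧ ∀ (x : X') (R : ℝ), 0 < R →
      μ' (Metric.closedBall x R) ≤ ENNReal.ofReal (C * R ^ α'))
    (hcompact : IsCompact (closure D))
    (hboundary : (frontier D).Nontrivial)
    (hQED : RingMaps.IsQEDClosure μ' α' D')
    (hloc : ∀ x ∈ closure D, RingMaps.LocPathConnectedAt D x)
    (hjoin : RingMaps.DisjointlyJoinable D)
    (Q : X → ℝ≥0∞) (hQ_meas : AEMeasurable Q μ) (hQ_zero : ∀ x ∉ D, Q x = 0)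
    (hQ_int : ∫⁻ x in D, Q x ∂μ < ⊤)
    (z₀ x₀ : D) (hzx : z₀ ≠ x₀) (z₀' x₀' : D') (hzx' : z₀' ≠ x₀') :
    (∀ f ∈ RingMaps.ringFamily μ μ' α α' z₀ x₀ z₀' x₀' Q,
      ∃ g : closure D' → closure D, RingMaps.IsExtendedInverse f g) ∧
    Set.Equicontinuous {g : closure D' → closure D |
      ∃ f ∈ RingMaps.ringFamily μ μ' α α' z₀ x₀ z₀' x₀' Q, RingMaps.IsExtendedInverse f g} := by
  obtain ⟨C, -, hC⟩ := hAhlfors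
  have S : RingMaps.InverseSetting μ μ' α α' D D' Q :=
    { nonneg := zero_le_two.trans hα
      one_lt := one_lt_two.trans_le hα'
      isOpen := hD_open
      isCompact_closure := hcompact
      nontrivial_frontier := hboundary
      locPathConnectedAt := hloc
      disjointlyJoinable := hjoin
      lintegral_ne_top := hQ_int.ne
      isLoewner := hLoewner
      upperMassBound := ⟨C, hC⟩
      isQEDClosure := hQED }
  refine ⟨fun f hf => RingMaps.exists_isExtendedInverse hcompact f fun z' _ ε hε => ?_, ?_⟩
  · obtain ⟨t, ht, h⟩ := S.exists_dist_lt hzx hzx' z' hε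
    exact ⟨t, ht, h f hf⟩
  · refine fun z => Metric.equicontinuousAt_iff.2 fun ε hε => ?_
    obtain ⟨t, ht, h⟩ := S.exists_dist_lt hzx hzx' z (half_pos hε)
    refine ⟨t, ht, ?_⟩
    rintro y hy ⟨g, f, hf, hg⟩
    have hle := hg.dist_le (h f hf) (y := z) (z := y) (by rwa [dist_self]) hy
    exact hle.trans_lt (half_lt_self hε)
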